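/- All hypergraphs are finite, with edges that are subsets of the vertex set (no repeated edges). A hypergraph is $k$-uniform if every edge has exactly $k$ vertices. A walk of length $s$ is a sequence $(v_0,e_1,v_1,\dots,e_s,v_s)$ with $v_{i-1},v_i\in e_i$ and $v_{i-1}\neq v_i$ for all $i$; it is a path if all $v_i$ are distinct and all $e_i$ are distinct, and a cycle if $s\ge 2$, all $e_i$ are distinct, and all $v_i$ are distinct except that $v_0=v_s$. A hypertree is a connected hypergraph (any two vertices are joined by a path) without cycles. The distance between two vertices is the length of a shortest path between them, and the diameter is the maximum distance between two vertices. For a $k$-uniform hypergraph $G$ with vertices $v_1,\dots,v_n$ and $0\le\alpha<1$, let $\mathcal A_\alpha(G)=\alpha\mathcal D(G)+(1-\alpha)\mathcal A(G)$, where $\mathcal A(G)$ is the tensor of order $k$ and dimension $n$ whose $(i_1,\dots,i_k)$-entry is $\frac1{(k-1)!}$ if $\{v_{i_1},\dots,v_{i_k}\}$ is an edge and $0$ otherwise, and $\mathcal D(G)$ is the diagonal tensor of order $k$ whose $(i,\dots,i)$-entry is the degree of $v_i$. A complex number $\lambda$ is an eigenvalue of a tensor $\mathcal T$ of order $k$ if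 there is a nonzero $x\in\mathbb C^n$ with $\sum_{i_2,\dots,i_k}\mathcal T_{i i_2\dots i_k}x_{i_2}\cdots x_{i_k}=\lambda x_i^{k-1}$ for all $i$. Let $\rho_\alpha(G)$ be the largest modulus of an eigenvalue of $\mathcal A_\alpha(G)$. For $k\ge2$ and $2\le d\le m$, let $P_{d,k}$ be the $k$-uniform loose path with $d$ edges $e_1,\dots,e_d$, where consecutive edges $e_i,e_{i+1}$ meet exactly in the vertex $v_i$ ($1\le i\le d-1$, these $d-1$ vertices being distinct) and nonconsecutive edges are disjoint, and let $S_{m,d,k}$ be obtained from $P_{d,k}$ by attaching $m-d$ pendant edges at $v_{\lfloor d/2\rfloor}$, each consisting of $v_{\lfloor d/2\rfloor}$ and $k-1$ new vertices. **Theorem.** Let $k\ge 2$, $d\ge2$ and $0\le\alpha<1$. If $d\le m$, then $S_{m,d,k}$ is a $k$-uniform hypertree with $m$ edges and diameter $d$. If $G$ is any $k$-uniform hypertree with $m$ edges and diameter $d$, then $d\le m$ and $$\rho_\alpha(G)\le\rho_\alpha(S_{m,d,k}),$$ with equality if and only if $G\cong S_{m,d,k}$. -/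

import Mathlib

/-! Hypergraphs are Mathlib's `Hypergraph V`: a vertex set `G.vertexSet : Set V` and a set
`G.edgeSet` of subsets of it. -/

namespace Hypergraph

/-- Every edge has exactly `k` vertices. -/
def IsUniform {V : Type*} (G : Hypergraph V) (k : ℕ) : Prop :=
  ∀ e ∈ G.edgeSet, e.Finite ∧ e.ncard = k

/-- The degree of `v` is the number of edges containing `v`. -/
noncomputable def degree {V : Type*} (G : Hypergraph V) (v : V) : ℕ :=
  {e | e ∈ G.edgeSet ∧ v ∈ e}.ncard

/-- `(v 0, e 0, v 1, e 1, …, e (s - 1), v s)` is a walk of length `s` in `G`. -/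
def IsWalk {V : Type*} (G : Hypergraph V) (s : ℕ) (v : Fin (s + 1) → V) (e : Fin s → Set V) :
    Prop :=
  (∀ i, v i ∈ G.vertexSet) ∧
    ∀ i : Fin s, e i ∈ G.edgeSet ∧ v i.castSucc ∈ e i ∧ v i.succ ∈ e i ∧ v i.castSucc ≠ v i.succ

/-- A path is a walk whose vertices are distinct and whose edges are distinct. -/
def IsPath {V : Type*} (G : Hypergraph V) (s : ℕ) (v : Fin (s + 1) → V) (e : Fin s → Set V) :
    Prop :=
  G.IsWalk s v e ∧ Function.Injective v ∧ Function.Injective e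

/-- A cycle is a walk with at least two edges, whose edges are distinct and whose vertices are
distinct except that the first and the last one are equal. -/
def IsCycle {V : Type*} (G : Hypergraph V) (s : ℕ) (v : Fin (s + 1) → V) (e : Fin s → Set V) :
    Prop :=
  G.IsWalk s v e ∧ 2 ≤ s ∧ Function.Injective e ∧
    Function.Injective (fun i : Fin s => v i.castSucc) ∧ v 0 = v (Fin.last s)

/-- There is a path of length `s` from `u` to `w`. -/
def HasPath {V : Type*} (G : Hypergraph V) (u w : V) (s : ℕ) : Prop :=
  ∃ (v : Fin (s + 1) → V) (e : Fin s → Set V), G.IsPath s v e ∧ v 0 = u ∧ v (Fin.last s) = w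

/-- Any two vertices are joined by a path (and there is at least one vertex). -/
def IsConnected {V : Type*} (G : Hypergraph V) : Prop :=
  G.vertexSet.Nonempty ∧ ∀ u ∈ G.vertexSet, ∀ w ∈ G.vertexSet, ∃ s, G.HasPath u w s

/-- A hypertree is a connected hypergraph without cycles. -/
def IsHypertree {V : Type*} (G : Hypergraph V) : Prop :=
  G.IsConnected ∧ ∀ (s : ℕ) (v : Fin (s + 1) → V) (e : Fin s → Set V), ¬ G.IsCycle s v e

/-- The length of a shortest path from `u` to `w`. -/
noncomputable def dist {V : Type*} (G : Hypergraph V) (u w : V) : ℕ :=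
  sInf {s | G.HasPath u w s}

/-- `d` is the diameter of `G`: the maximum distance between two vertices. -/
def HasDiameter {V : Type*} (G : Hypergraph V) (d : ℕ) : Prop :=
  IsGreatest {s | ∃ u ∈ G.vertexSet, ∃ w ∈ G.vertexSet, G.dist u w = s} d

/-- `G` is a `k`-uniform hypertree with `m` edges and diameter `d`. -/
structure IsUniformHypertree {V : Type*} (G : Hypergraph V) (k m d : ℕ) : Prop where
  isUniform : G.IsUniform k
  isHypertree : G.IsHypertree
  edgeSet_finite : G.edgeSet.Finite
  ncard_edgeSet : G.edgeSet.ncard = m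
  hasDiameter : G.HasDiameter d

/-- `G` and `H` are isomorphic: some bijection of the vertex sets maps edges to edges in both
directions. -/
def IsIsomorphic {V W : Type*} (G : Hypergraph V) (H : Hypergraph W) : Prop :=
  ∃ φ : G.vertexSet ≃ H.vertexSet, ∀ s : Set G.vertexSet,
    Subtype.val '' s ∈ G.edgeSet ↔ Subtype.val '' (φ '' s) ∈ H.edgeSet

end Hypergraph

/-- A complex tensor of order `r + 1` whose indices range over `ι`. -/
abbrev HTensor (ι : Type*) (r : ℕ) : Type _ := (Fin (r + 1) → ι) → ℂ

namespace HTensor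

/-- The vector `T x`, with entries `∑ T (i, i₂, …, i_{r+1}) * x i₂ * ⋯ * x i_{r+1}`. -/
noncomputable def apply {ι : Type*} [Fintype ι] {r : ℕ} (T : HTensor ι r) (x : ι → ℂ) : ι → ℂ :=
  fun i => ∑ f : Fin r → ι, T (Fin.cons i f) * ∏ j, x (f j)

/-- `μ` is an eigenvalue: `T x = μ x^{[r]}` for some nonzero vector `x` (the order is `r + 1`). -/
def IsEigenvalue {ι : Type*} [Fintype ι] {r : ℕ} (T : HTensor ι r) (μ : ℂ) : Prop :=
  ∃ x : ι → ℂ, x ≠ 0 ∧ ∀ i, T.apply x i = μ * x i ^ r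

/-- The largest modulus of an eigenvalue. -/
noncomputable def spectralRadius {ι : Type*} [Fintype ι] {r : ℕ} (T : HTensor ι r) : ℝ :=
  sSup {t | ∃ μ : ℂ, T.IsEigenvalue μ ∧ ‖μ‖ = t}

end HTensor

namespace Hypergraph

open Classical in
/-- The adjacency tensor of a `k`-uniform hypergraph. It has order `k`, which is written
`(k - 1) + 1` here, and `k ≥ 1`. -/
noncomputable def adjTensor {V : Type*} (G : Hypergraph V) (k : ℕ) :
    HTensor G.vertexSet (k - 1) :=
  fun f => if Set.range (fun j => (f j : V)) ∈ G.edgeSet then 1 / ((k - 1).factorial : ℂ) else 0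

open Classical in
/-- The degree tensor of order `k`: it is diagonal, and its diagonal entries are the degrees. -/
noncomputable def degTensor {V : Type*} (G : Hypergraph V) (k : ℕ) :
    HTensor G.vertexSet (k - 1) :=
  fun f => if ∀ j, f j = f 0 then (G.degree (f 0 : V) : ℂ) else 0

/-- The tensor `α D(G) + (1 - α) A(G)`. -/
noncomputable def alphaTensor {V : Type*} (G : Hypergraph V) (k : ℕ) (α : ℝ) :
    HTensor G.vertexSet (k - 1) :=
  fun f => (α : ℂ) * G.degTensor k f + (1 - (α : ℂ)) * G.adjTensor k f

/-- The `α`-spectral radius of a `k`-uniform hypergraph. -/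
noncomputable def alphaSpectralRadius {V : Type*} (G : Hypergraph V) [Fintype G.vertexSet]
    (k : ℕ) (α : ℝ) : ℝ :=
  (G.alphaTensor k α).spectralRadius

/-- For `2 ≤ d ≤ m` and `k ≥ 2`, the hypergraph `S_{m,d,k}`. Its vertices are `0, …, (k - 1) * m`.
The loose path with `d` edges has the vertices `v_i = (k - 1) * i` and the edges
`e_{j+1} = {v_j, v_j + 1, …, v_{j+1}}` for `j < d`. Then `m - d` pendant edges are attached at
`v_{⌊d/2⌋}`, each of which consists of that vertex and `k - 1` new vertices. -/
def pathWithPendants (m d k : ℕ) : Hypergraph ℕ where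
  vertexSet := Set.Iic ((k - 1) * (d + (m - d)))
  edgeSet :=
    {e | ∃ j < d, e = Set.Icc ((k - 1) * j) ((k - 1) * (j + 1))} ∪
    {e | ∃ j < m - d, e = insert ((k - 1) * (d / 2))
      (Set.Ioc ((k - 1) * (d + j)) ((k - 1) * (d + j + 1)))}
  subset_vertexSet_of_mem_edgeSet' := by
    rintro e (⟨j, hj, rfl⟩ | ⟨j, hj, rfl⟩) x hx
    · exact hx.2.trans (Nat.mul_le_mul_left _ (by omega))
    · rcases hx with rfl | hx
      · exact Nat.mul_le_mul_left _ (by omega)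
      · exact hx.2.trans (Nat.mul_le_mul_left _ (by omega))

instance (m d k : ℕ) : Fintype (pathWithPendants m d k).vertexSet :=
  inferInstanceAs (Fintype (Set.Iic ((k - 1) * (d + (m - d)))))

end Hypergraph

/-! Put ρ = c + α. For a nonnegative vector x, the form `edgeForm` is bounded edge by edge. By AM–GM
an edge contributes at most ∑ B_v x_v^k over its vertices, for any labels B_v ≥ α with ∏ (B_v − α) =
(1 − α)^k. If the labels at each vertex add up to at most ρ, the form is at most ρ ∑ x_v^k. For the
broom S_{m,d,k} the right labels are given by the recursion `branchLabel`, g_{j+1} = α + K / (c −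
g_j), along its branches. By `exists_branchLabel_balance` there are c and K with K c^(k−2) = (1 −
α)^k for which the total at the centre is exactly ρ.

Now let G be any hypertree of diameter d with m edges, and fix a path with d edges in it. Given x,
root G at a vertex u where x is largest (`IsHypertree.exists_isRooting`). Every other vertex is a
child in exactly one edge. Replacing the value at the nearest vertex of an edge by x_u only
increases the bound, so an edge off the path may be charged to u as if it were pendant there. The
path runs towards the root, turns at some index i, and runs away again (`IsRooting.exists_turn`).
Its two parts are likewise charged to u, as branches of i and d − i edges. The total at u is then
g_i + g_{d−i} + (m − d) g_1. By `branchLabel_add_le` this is largest for i in the middle, where it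
equals ρ. Thus G is compared with the broom directly, by a labelling that depends on x; this is
`edgeForm_le_of_isPath`.

If m > d, equality for a nonzero x forces i to be in the middle and x to decrease strictly away from
u. Hence no replacement by u took place: u is the middle vertex of the path and lies in all edges
off it. Such a configuration determines G (`IsBroomPath.isIsomorphic`). If m = d, the path is all of
G.

For an eigenvector y, the vector |y| turns bounds on the form into bounds on eigenvalues, and
compactness keeps strict bounds strict. On the broom, a positive vector with equality in every edge
is a maximiser, hence an eigenvector for ρ, so no Perron–Frobenius theory is needed. -/

namespace Hypergraph

/-! ### Paths, and hypertrees rooted at a vertex -/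

variable {V : Type*} {G : Hypergraph V}

theorem IsPath.rev {s : ℕ} {v : Fin (s + 1) → V} {e : Fin s → Set V} (h : G.IsPath s v e) :
    G.IsPath s (v ∘ Fin.rev) (e ∘ Fin.rev) := by
  obtain ⟨⟨hv, he⟩, hvi, hei⟩ := h
  refine ⟨⟨fun i => hv _, fun i => ?_⟩, hvi.comp Fin.rev_injective, hei.comp Fin.rev_injective⟩
  obtain ⟨h1, h2, h3, h4⟩ := he i.rev
  simp only [Function.comp, Fin.rev_castSucc, Fin.rev_succ]
  exact ⟨h1, h3, h2, h4.symm⟩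

theorem IsWalk.snoc {s : ℕ} {v : Fin (s + 1) → V} {e : Fin s → Set V} (h : G.IsWalk s v e)
    {f : Set V} (hf : f ∈ G.edgeSet) {z : V} (hl : v (Fin.last s) ∈ f) (hz : z ∈ f)
    (hne : v (Fin.last s) ≠ z) :
    G.IsWalk (s + 1) (Fin.snoc v z : Fin (s + 2) → V) (Fin.snoc e f : Fin (s + 1) → Set V) := by
  refine ⟨fun i => ?_, fun i => ?_⟩
  · induction i using Fin.lastCases with
    | last => simpa using G.subset_vertexSet_of_mem_edgeSet' hf hz
    | cast i => simpa using h.1 i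
  · induction i using Fin.lastCases with
    | last => simpa using ⟨hf, hl, hz, hne⟩
    | cast i => simpa [← Fin.castSucc_succ] using h.2 i

theorem snoc_injective {α : Type*} {n : ℕ} {v : Fin n → α} (hv : Function.Injective v) {z : α}
    (hz : ∀ i, v i ≠ z) : Function.Injective (Fin.snoc v z : Fin (n + 1) → α) := by
  intro i j hij
  induction i using Fin.lastCases with
  | last =>
    induction j using Fin.lastCases with
    | last => rfl
    | cast j => exact absurd (by simpa using hij.symm) (hz j)
  | cast i =>
    induction j using Fin.lastCases with
    | last => exact absurd (by simpa using hij) (hz i)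
    | cast j =>
      have : v i = v j := by simpa using hij
      rw [hv this]

/-- There is a path of length `s` from `u` to `w` with vertices in `W` and edges in `E`. -/
def PathIn (G : Hypergraph V) (W : Set V) (E : Set (Set V)) (u w : V) (s : ℕ) : Prop :=
  ∃ (v : Fin (s + 1) → V) (e : Fin s → Set V), G.IsPath s v e ∧ v 0 = u ∧ v (Fin.last s) = w ∧
    (∀ i, v i ∈ W) ∧ ∀ i, e i ∈ E

theorem PathIn.hasPath {W : Set V} {E : Set (Set V)} {u w : V} {s : ℕ}
    (h : G.PathIn W E u w s) : G.HasPath u w s := by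
  obtain ⟨v, e, h, h0, hl, -⟩ := h
  exact ⟨v, e, h, h0, hl⟩

theorem PathIn.symm {W : Set V} {E : Set (Set V)} {u w : V} {s : ℕ}
    (h : G.PathIn W E u w s) : G.PathIn W E w u s := by
  obtain ⟨v, e, h, h0, hl, hW, hE⟩ := h
  exact ⟨_, _, h.rev, by simpa using hl, by simpa using h0, fun i => hW _, fun i => hE _⟩

theorem PathIn.mono {W W' : Set V} {E E' : Set (Set V)} {u w : V} {s : ℕ}
    (h : G.PathIn W E u w s) (hW : W ⊆ W') (hE : E ⊆ E') : G.PathIn W' E' u w s := by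
  obtain ⟨v, e, h, h0, hl, hW', hE'⟩ := h
  exact ⟨v, e, h, h0, hl, fun i => hW (hW' i), fun i => hE (hE' i)⟩

theorem PathIn.refl {W : Set V} {E : Set (Set V)} {u : V} (hu : u ∈ W) (huV : u ∈ G.vertexSet) :
    G.PathIn W E u u 0 :=
  ⟨fun _ => u, Fin.elim0, ⟨⟨fun _ => huV, fun i => i.elim0⟩,
    fun i j _ => Subsingleton.elim (α := Fin 1) i j, fun i => i.elim0⟩, rfl, rfl, fun _ => hu,
    fun i => i.elim0⟩

theorem PathIn.snoc {W : Set V} {E : Set (Set V)} {u w : V} {s : ℕ}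
    (h : G.PathIn W E u w s) {f : Set V} (hf : f ∈ G.edgeSet) (hfE : f ∉ E) {z : V}
    (hw : w ∈ f) (hz : z ∈ f) (hzW : z ∉ W) : G.PathIn (W ∪ f) (insert f E) u z (s + 1) := by
  obtain ⟨v, e, h, h0, hl, hW, hE⟩ := h
  have hne : ∀ i, v i ≠ z := fun i hi => hzW (hi ▸ hW i)
  refine ⟨Fin.snoc v z, Fin.snoc e f, ⟨h.1.snoc hf (hl ▸ hw) hz (hne _),
    snoc_injective h.2.1 hne, snoc_injective h.2.2 fun i hi => hfE (hi ▸ hE i)⟩, ?_, by simp,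
    fun i => ?_, fun i => ?_⟩
  · rw [← Fin.castSucc_zero, Fin.snoc_castSucc, h0]
  · induction i using Fin.lastCases with
    | last => simpa using Or.inr hz
    | cast i => simpa using Or.inl (hW i)
  · induction i using Fin.lastCases with
    | last => simp
    | cast i => simpa using Or.inr (hE i)

theorem PathIn.single {f : Set V} (hf : f ∈ G.edgeSet) {u w : V} (hu : u ∈ f) (hw : w ∈ f)
    (huw : u ≠ w) : G.PathIn f {f} u w 1 :=
  ((PathIn.refl (E := ∅) (Set.mem_singleton u)
    (G.subset_vertexSet_of_mem_edgeSet' hf hu)).snoc hf (by simp) hu hw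
    (by simpa using huw.symm)).mono (Set.union_subset (by simpa using hu) le_rfl) (by simp)

/-- The edge `f` closes the path, and it is new because all edges of the path lie in `E`. Acyclicity
of a hypertree is exploited through this. -/
theorem PathIn.exists_cycle {W : Set V} {E : Set (Set V)} {a b : V} {t : ℕ}
    (h : G.PathIn W E a b t) (hab : a ≠ b) {f : Set V} (hf : f ∈ G.edgeSet) (hfE : f ∉ E)
    (ha : a ∈ f) (hb : b ∈ f) :
    ∃ (s : ℕ) (v : Fin (s + 1) → V) (e : Fin s → Set V), G.IsCycle s v e := by
  obtain ⟨v, e, h, h0, hl, hW, hE⟩ := h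
  refine ⟨t + 1, Fin.snoc v a, Fin.snoc e f, h.1.snoc hf (hl ▸ hb) ha (hl ▸ hab.symm), ?_,
    snoc_injective h.2.2 fun i hi => hfE (hi ▸ hE i), ?_, ?_⟩
  · rcases t with _ | t
    · exact absurd (h0.symm.trans hl) hab
    · omega
  · simpa using h.2.1
  · rw [← Fin.castSucc_zero, Fin.snoc_castSucc, h0, Fin.snoc_last]

/-- Any two vertices in `W` are joined by a path of length at most `s` with edges in `E`. -/
def PathConn (G : Hypergraph V) (W : Set V) (E : Set (Set V)) (s : ℕ) : Prop :=
  ∀ u ∈ W, ∀ w ∈ W, ∃ t ≤ s, G.PathIn W E u w t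

theorem pathConn_edge {f : Set V} (hf : f ∈ G.edgeSet) : G.PathConn f {f} 1 := by
  intro u hu w hw
  by_cases huw : u = w
  · subst huw
    exact ⟨0, Nat.zero_le _, PathIn.refl hu (G.subset_vertexSet_of_mem_edgeSet' hf hu)⟩
  · exact ⟨1, le_rfl, PathIn.single hf hu hw huw⟩

theorem PathConn.extend {W : Set V} {E : Set (Set V)} {s : ℕ} (h : G.PathConn W E s)
    {f : Set V} (hf : f ∈ G.edgeSet) (hfE : f ∉ E) {w : V} (hwW : w ∈ W) (hwf : w ∈ f) :
    G.PathConn (W ∪ f) (insert f E) (s + 1) := by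
  have key : ∀ a ∈ W, ∀ z ∈ f, ∃ t ≤ s + 1, G.PathIn (W ∪ f) (insert f E) a z t := by
    intro a ha z hz
    by_cases hzW : z ∈ W
    · obtain ⟨t, ht, hp⟩ := h a ha z hzW
      exact ⟨t, by omega, hp.mono Set.subset_union_left (Set.subset_insert _ _)⟩
    · obtain ⟨t, ht, hp⟩ := h a ha w hwW
      exact ⟨t + 1, by omega, hp.snoc hf hfE hwf hz hzW⟩
  rintro a (ha | ha) b (hb | hb)
  · obtain ⟨t, ht, hp⟩ := h a ha b hb
    exact ⟨t, by omega, hp.mono Set.subset_union_left (Set.subset_insert _ _)⟩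
  · exact key a ha b hb
  · obtain ⟨t, ht, hp⟩ := key b hb a ha
    exact ⟨t, ht, hp.symm⟩
  · obtain ⟨t, ht, hp⟩ := pathConn_edge hf a ha b hb
    exact ⟨t, by omega, hp.mono Set.subset_union_right (by simp)⟩

/-- `r` assigns to each edge its vertex nearest to the root `u`: every other vertex is, in exactly
one edge, a vertex different from the nearest one. -/
structure IsRooting (G : Hypergraph V) (u : V) (r : Set V → V) : Prop where
  mem : ∀ e ∈ G.edgeSet, r e ∈ e
  root : ∀ e ∈ G.edgeSet, u ∈ e → r e = u
  exists_child : ∀ w ∈ G.vertexSet, w ≠ u → ∃ e ∈ G.edgeSet, w ∈ e ∧ w ≠ r e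
  child_unique : ∀ e ∈ G.edgeSet, ∀ f ∈ G.edgeSet, ∀ w, w ∈ e → w ≠ r e → w ∈ f → w ≠ r f → e = f

/-- Otherwise a path from `u` to a vertex of a missing edge could never leave the part covered by
`E`. -/
theorem IsConnected.exists_edge_meeting (hG : G.IsConnected) (hne : ∀ e ∈ G.edgeSet, e.Nonempty)
    {u : V} (hu : u ∈ G.vertexSet) {E : Set (Set V)} (hE : ∃ e ∈ G.edgeSet, e ∉ E) :
    ∃ e ∈ G.edgeSet, e ∉ E ∧ ∃ w ∈ insert u (⋃₀ E), w ∈ e := by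
  obtain ⟨e0, he0, he0E⟩ := hE
  obtain ⟨z, hz⟩ := hne e0 he0
  obtain ⟨s, v, e, ⟨⟨hv, he⟩, -⟩, h0, hl⟩ :=
    hG.2 u hu z (G.subset_vertexSet_of_mem_edgeSet' he0 hz)
  by_contra hcon
  push Not at hcon
  have hall : ∀ i, v i ∈ insert u (⋃₀ E) := by
    intro i
    induction i using Fin.induction with
    | zero => exact h0 ▸ Set.mem_insert _ _
    | succ i ih =>
      by_cases hiE : e i ∈ E
      · exact Set.mem_insert_of_mem _ ⟨e i, hiE, (he i).2.2.1⟩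
      · exact absurd (he i).2.1 (hcon _ (he i).1 hiE _ ih)
  exact hcon e0 he0 he0E _ (hl ▸ hall _) hz

/-- Edges are added one at a time, starting from `u`. A new edge meets the part already built in
exactly one vertex, because two such vertices would be joined inside that part and the edge would
close a cycle. This vertex becomes the nearest one, and all others are new children. -/
theorem IsHypertree.exists_isRooting (hG : G.IsHypertree) (hfin : G.edgeSet.Finite)
    (hne : ∀ e ∈ G.edgeSet, e.Nonempty) {u : V} (hu : u ∈ G.vertexSet) :
    ∃ r, G.IsRooting u r := by
  classical
  have grow : ∀ n ≤ G.edgeSet.ncard, ∃ (E : Set (Set V)) (r : Set V → V), E ⊆ G.edgeSet ∧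
      E.ncard = n ∧ (∃ s, G.PathConn (insert u (⋃₀ E)) E s) ∧ (∀ e ∈ E, r e ∈ e) ∧
      (∀ e ∈ E, u ∈ e → r e = u) ∧
      (∀ w ∈ insert u (⋃₀ E), w ≠ u → ∃ e ∈ E, w ∈ e ∧ w ≠ r e) ∧
      (∀ e ∈ E, ∀ f ∈ E, ∀ w, w ∈ e → w ≠ r e → w ∈ f → w ≠ r f → e = f) := by
    intro n
    induction n with
    | zero =>
      intro _
      refine ⟨∅, fun _ => u, by simp, by simp, ⟨0, ?_⟩, by simp, by simp, by simp, by simp⟩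
      intro a ha b hb
      simp only [Set.sUnion_empty, insert_empty_eq, Set.mem_singleton_iff] at ha hb
      subst ha hb
      exact ⟨0, le_rfl, PathIn.refl (by simp) hu⟩
    | succ n ih =>
      intro hn
      obtain ⟨E, r, hEG, hcard, ⟨s, hconn⟩, hmem, hroot, hex, huni⟩ := ih (by omega)
      have hex' : ∃ e ∈ G.edgeSet, e ∉ E := by
        by_contra hcon
        push Not at hcon
        rw [hEG.antisymm hcon] at hcard
        omega
      obtain ⟨f, hf, hfE, w, hwW, hwf⟩ := hG.1.exists_edge_meeting hne hu hex'
      have hmeet : ∀ z ∈ f, z ∈ insert u (⋃₀ E) → z = w := by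
        intro z hz hzW
        by_contra hzw
        obtain ⟨t, -, hp⟩ := hconn z hzW w hwW
        obtain ⟨s, v, e, hc⟩ := hp.exists_cycle hzw hf hfE hz hwf
        exact hG.2 s v e hc
      have hr : ∀ e ∈ E, Function.update r f w e = r e := fun e he =>
        Function.update_of_ne (fun h : e = f => hfE (h ▸ he)) _ _
      have hrf : Function.update r f w f = w := Function.update_self _ _ _
      refine ⟨insert f E, Function.update r f w, Set.insert_subset hf hEG, ?_, ⟨s + 1, ?_⟩,
        ?_, ?_, ?_, ?_⟩
      · rw [Set.ncard_insert_of_notMem hfE (hfin.subset hEG), hcard]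
      · have := hconn.extend hf hfE hwW hwf
        rwa [Set.insert_union, Set.union_comm, ← Set.sUnion_insert] at this
      · rintro e (rfl | he)
        · rwa [hrf]
        · rw [hr e he]; exact hmem e he
      · rintro e (rfl | he) hue
        · rw [hrf]; exact (hmeet u hue (Set.mem_insert _ _)).symm
        · rw [hr e he]; exact hroot e he hue
      · intro z hz hzu
        by_cases hzW : z ∈ insert u (⋃₀ E)
        · obtain ⟨e, he, hze, hzr⟩ := hex z hzW hzu
          exact ⟨e, Set.mem_insert_of_mem _ he, hze, by rwa [hr e he]⟩
        · rw [Set.sUnion_insert, Set.union_comm, ← Set.insert_union] at hz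
          have hzf := hz.resolve_left hzW
          exact ⟨f, Set.mem_insert _ _, hzf, by rw [hrf]; exact fun h => hzW (h ▸ hwW)⟩
      · have key : ∀ e ∈ E, ∀ z ∈ e, z ∈ f → z = w := fun e he z hze hzf =>
          hmeet z hzf (Set.mem_insert_of_mem _ ⟨e, he, hze⟩)
        rintro e (rfl | he) e' (rfl | he') z hze hzr hze' hzr'
        · rfl
        · rw [hrf] at hzr; exact absurd (key e' he' z hze' hze) hzr
        · rw [hrf] at hzr'; exact absurd (key e he z hze hze') hzr'
        · rw [hr e he] at hzr
          rw [hr e' he'] at hzr'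
          exact huni e he e' he' z hze hzr hze' hzr'
  obtain ⟨E, r, hEG, hcard, -, hmem, hroot, hex, huni⟩ := grow _ le_rfl
  obtain rfl : E = G.edgeSet := Set.eq_of_subset_of_ncard_le hEG hcard.ge hfin
  refine ⟨r, hmem, hroot, fun w hw hwu => hex w ?_ hwu, huni⟩
  obtain ⟨s, v, e, ⟨⟨hv, he⟩, -⟩, h0, hl⟩ := hG.1.2 u hu w hw
  rcases s with _ | s
  · exact absurd (hl.symm.trans h0) hwu
  · exact Set.mem_insert_of_mem _ ⟨_, (he (Fin.last s)).1, by
      have := (he (Fin.last s)).2.2.1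
      rwa [Fin.succ_last, hl] at this⟩

/-- A path enters the children of its edges first towards the root and then away from it. -/
theorem IsRooting.exists_turn {u : V} {r : Set V → V} (hr : G.IsRooting u r) {d : ℕ}
    {v : Fin (d + 1) → V} {e : Fin d → Set V} (h : G.IsPath d v e) :
    ∃ i ≤ d, (∀ j : Fin d, j.val < i → v j.castSucc ≠ r (e j)) ∧
      (∀ j : Fin d, j.val + 1 < i → r (e j) = v j.succ) ∧
      ∀ j : Fin d, i ≤ j.val → r (e j) = v j.castSucc := by
  classical
  -- An inner vertex of the path cannot be a child in both path edges at it.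
  have step : ∀ j j' : Fin d, j.val + 1 = j'.val → v j.succ = r (e j) ∨ v j.succ = r (e j') := by
    intro j j' hj
    by_contra hcon
    push Not at hcon
    have hjj : j.succ = j'.castSucc := Fin.ext (by simpa using hj)
    have := hr.child_unique _ (h.1.2 j).1 _ (h.1.2 j').1 _ (h.1.2 j).2.2.1 hcon.1
      (hjj ▸ (h.1.2 j').2.1) hcon.2
    have := h.2.2 this
    rw [this] at hj
    omega
  -- The turn is the first `i` at which the path leaves an edge's nearest vertex. The nearest vertex
  -- of the edge before the turn may lie off the path, hence `j + 1 < i` in the second clause.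
  by_cases hex : ∃ i, ∃ hi : i < d, r (e ⟨i, hi⟩) = v (Fin.castSucc ⟨i, hi⟩)
  · have hspec := Nat.find_spec hex
    have hmin := fun m (hm : m < Nat.find hex) => Nat.find_min hex hm
    set i := Nat.find hex
    obtain ⟨hi, hri⟩ := hspec
    have hlt : ∀ j : Fin d, j.val < i → v j.castSucc ≠ r (e j) := fun j hj hcon =>
      hmin j hj ⟨j.2, hcon.symm⟩
    refine ⟨i, hi.le, hlt, ?_, ?_⟩
    · intro j hj
      have hj' : j.val + 1 < d := by omega
      rcases step j ⟨j.val + 1, hj'⟩ rfl with h1 | h1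
      · exact h1.symm
      · exact absurd h1 (hlt ⟨j.val + 1, hj'⟩ hj)
    · suffices hs : ∀ j, i ≤ j → ∀ hj : j < d, r (e ⟨j, hj⟩) = v (Fin.castSucc ⟨j, hj⟩) from
        fun j hj => hs j hj j.2
      intro j hij
      induction j, hij using Nat.le_induction with
      | base => exact fun _ => hri
      | succ j hij ih =>
        intro hj
        have ih := ih (by omega)
        rcases step ⟨j, by omega⟩ ⟨j + 1, hj⟩ rfl with h1 | h1
        · rw [ih] at h1
          exact absurd (h.2.1 h1) (by simp [Fin.ext_iff])
        · exact h1.symm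
  · push Not at hex
    refine ⟨d, le_rfl, fun j _ hcon => hex j j.2 hcon.symm, ?_, fun j hj => absurd j.2 (by omega)⟩
    intro j hj
    rcases step j ⟨j.val + 1, hj⟩ rfl with h1 | h1
    · exact h1.symm
    · exact absurd h1.symm (hex _ hj)

end Hypergraph

/-! ### `pathWithPendants` is a hypertree of diameter `d` -/

namespace Hypergraph

variable {V : Type*} {G : Hypergraph V}

/-- A vertex of highest level on a cycle would be a child in both cycle edges at it, so these edges
would coincide. -/
theorem not_isCycle_of_level {r : Set V → V} (lev : V → ℕ)
    (hlev : ∀ e ∈ G.edgeSet, ∀ w ∈ e, w ≠ r e → lev (r e) < lev w)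
    (huni : ∀ e ∈ G.edgeSet, ∀ f ∈ G.edgeSet, ∀ w, w ∈ e → w ≠ r e → w ∈ f → w ≠ r f → e = f)
    {s : ℕ} {v : Fin (s + 1) → V} {e : Fin s → Set V} : ¬ G.IsCycle s v e := by
  rintro ⟨⟨-, he⟩, hs, hei, -, hcl⟩
  have : Nonempty (Fin s) := ⟨⟨0, by omega⟩⟩
  obtain ⟨j, hj⟩ := Finite.exists_max (fun i : Fin s => lev (v i.castSucc))
  have hmax : ∀ i, lev (v i) ≤ lev (v j.castSucc) := by
    intro i
    induction i using Fin.lastCases with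
    | last => rw [← hcl]; exact hj ⟨0, by omega⟩
    | cast i => exact hj i
  have hchild : ∀ i, v j.castSucc ∈ e i → ∀ l, v l ∈ e i → v l ≠ v j.castSucc →
      v j.castSucc ≠ r (e i) := by
    intro i _ l hl hne hcon
    have := hlev _ (he i).1 _ hl (hcon ▸ hne)
    rw [← hcon] at this
    exact absurd (hmax l) (by omega)
  -- The preceding cycle edge; for `j = 0` it is the last one.
  obtain ⟨j', hj', hjj⟩ : ∃ j' : Fin s, v j'.succ = v j.castSucc ∧ j' ≠ j := by
    rcases j with ⟨_ | n, hn⟩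
    · refine ⟨⟨s - 1, by omega⟩, ?_, by simp [Fin.ext_iff]; omega⟩
      rw [show Fin.succ (⟨s - 1, by omega⟩ : Fin s) = Fin.last s from Fin.ext (by simp; omega),
        ← hcl]
      rfl
    · exact ⟨⟨n, by omega⟩, rfl, by simp [Fin.ext_iff]⟩
  have h1 := hchild j (he j).2.1 _ (he j).2.2.1 (he j).2.2.2.symm
  have hmem : v j.castSucc ∈ e j' := hj' ▸ (he j').2.2.1
  have h2 := hchild j' hmem _ (he j').2.1 (hj' ▸ (he j').2.2.2)
  exact hjj (hei (huni _ (he j').1 _ (he j).1 _ hmem h2 (he j).2.1 h1))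

/-- The edge of `pathWithPendants m d (K + 1)` whose vertices, apart from one of them, form the
`j`-th block of `K` numbers. -/
def blockEdge (d K j : ℕ) : Set ℕ :=
  insert (K * if j < d then j else d / 2) (Set.Ioc (K * j) (K * (j + 1)))

theorem blockEdge_of_lt {d K j : ℕ} (h : j < d) :
    blockEdge d K j = Set.Icc (K * j) (K * (j + 1)) := by
  rw [blockEdge, if_pos h, Set.Ioc_insert_left (Nat.mul_le_mul_left _ (by omega))]

theorem blockEdge_of_le {d K j : ℕ} (h : d ≤ j) :
    blockEdge d K j = insert (K * (d / 2)) (Set.Ioc (K * j) (K * (j + 1))) := by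
  rw [blockEdge, if_neg (by omega)]

theorem vertexSet_pathWithPendants {m d k : ℕ} (hdm : d ≤ m) :
    (pathWithPendants m d k).vertexSet = Set.Iic ((k - 1) * m) := by
  simp [pathWithPendants, Nat.add_sub_cancel' hdm]

theorem mem_edgeSet_pathWithPendants {m d k : ℕ} (hdm : d ≤ m) {e : Set ℕ} :
    e ∈ (pathWithPendants m d k).edgeSet ↔ ∃ j < m, e = blockEdge d (k - 1) j := by
  constructor
  · rintro (⟨j, hj, rfl⟩ | ⟨j, hj, rfl⟩)
    · exact ⟨j, by omega, (blockEdge_of_lt hj).symm⟩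
    · exact ⟨d + j, by omega, (blockEdge_of_le (by omega)).symm⟩
  · rintro ⟨j, hj, rfl⟩
    by_cases h : j < d
    · exact Or.inl ⟨j, h, blockEdge_of_lt h⟩
    · refine Or.inr ⟨j - d, by omega, ?_⟩
      rw [blockEdge_of_le (by omega), show d + (j - d) = j by omega]

theorem blockEdge_base_le {d K j : ℕ} : K * (if j < d then j else d / 2) ≤ K * j :=
  Nat.mul_le_mul_left _ (by split_ifs <;> omega)

/-- With the root at `0`, the least element of an edge is its nearest vertex. -/
theorem sInf_blockEdge {d K j : ℕ} :
    sInf (blockEdge d K j) = K * if j < d then j else d / 2 := by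
  refine (IsLeast.csInf_eq ⟨Set.mem_insert _ _, ?_⟩)
  rintro x (rfl | hx)
  · exact le_rfl
  · exact blockEdge_base_le.trans hx.1.le

theorem mem_Ioc_of_mem_blockEdge {d K j x : ℕ} (hx : x ∈ blockEdge d K j)
    (hne : x ≠ sInf (blockEdge d K j)) : x ∈ Set.Ioc (K * j) (K * (j + 1)) := by
  rw [sInf_blockEdge] at hne
  exact hx.resolve_left hne

theorem eq_of_mem_block {K i j x : ℕ} (hi : x ∈ Set.Ioc (K * i) (K * (i + 1)))
    (hj : x ∈ Set.Ioc (K * j) (K * (j + 1))) : i = j := by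
  have h1 := lt_of_mul_lt_mul_left (hi.1.trans_le hj.2) (Nat.zero_le _)
  have h2 := lt_of_mul_lt_mul_left (hj.1.trans_le hi.2) (Nat.zero_le _)
  omega

theorem blockEdge_injective {d K : ℕ} (hK : 1 ≤ K) : Function.Injective (blockEdge d K) := by
  intro i j hij
  have hx : K * (i + 1) ∈ Set.Ioc (K * i) (K * (i + 1)) := ⟨by rw [mul_add]; omega, le_rfl⟩
  have hne : K * (i + 1) ≠ sInf (blockEdge d K i) := by
    rw [sInf_blockEdge]
    exact (blockEdge_base_le.trans_lt hx.1).ne'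
  have hmem : K * (i + 1) ∈ blockEdge d K i := Set.mem_insert_of_mem _ hx
  rw [hij] at hmem hne
  exact eq_of_mem_block hx (mem_Ioc_of_mem_blockEdge hmem hne)

theorem finite_blockEdge {d K j : ℕ} : (blockEdge d K j).Finite :=
  (Set.finite_Ioc _ _).insert _

theorem ncard_blockEdge {d K j : ℕ} : (blockEdge d K j).ncard = K + 1 := by
  rw [blockEdge, Set.ncard_insert_of_notMem (fun h => absurd h.1 (by
    have := blockEdge_base_le (d := d) (K := K) (j := j); omega)) (Set.finite_Ioc _ _),
    ← Finset.coe_Ioc, Set.ncard_coe_finset, Nat.card_Ioc, mul_add]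
  omega

theorem edgeSet_pathWithPendants {m d k : ℕ} (hdm : d ≤ m) :
    (pathWithPendants m d k).edgeSet = blockEdge d (k - 1) '' Set.Iio m := by
  ext e
  rw [mem_edgeSet_pathWithPendants hdm]
  simp [eq_comm]

theorem ncard_edgeSet_pathWithPendants {m d k : ℕ} (hk : 2 ≤ k) (hdm : d ≤ m) :
    (pathWithPendants m d k).edgeSet.ncard = m := by
  rw [edgeSet_pathWithPendants hdm, Set.ncard_image_of_injective _ (blockEdge_injective (by omega)),
    ← Finset.coe_Iio, Set.ncard_coe_finset, Nat.card_Iio]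

theorem pathConn_spine {m d k : ℕ} (hk : 2 ≤ k) (hdm : d ≤ m) {i j : ℕ} (hij : i ≤ j)
    (hjd : j ≤ d) : (pathWithPendants m d k).PathConn (Set.Icc ((k - 1) * i) ((k - 1) * j))
      {e | ∃ t < j, e = blockEdge d (k - 1) t} (j - i) := by
  induction j, hij using Nat.le_induction with
  | base =>
    rintro a ⟨ha1, ha2⟩ b ⟨hb1, hb2⟩
    obtain rfl : a = b := by omega
    refine ⟨0, Nat.zero_le _, PathIn.refl ⟨ha1, ha2⟩ ?_⟩
    rw [vertexSet_pathWithPendants hdm]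
    exact ha2.trans (Nat.mul_le_mul_left _ (by omega))
  | succ j hij ih =>
    have hl : (k - 1) * j ≤ (k - 1) * (j + 1) := Nat.mul_le_mul_left _ (by omega)
    have hl' : (k - 1) * i ≤ (k - 1) * j := Nat.mul_le_mul_left _ (by omega)
    have := (ih (by omega)).extend (f := blockEdge d (k - 1) j) (w := (k - 1) * j)
      ((mem_edgeSet_pathWithPendants hdm).2 ⟨j, by omega, rfl⟩) ?_ ⟨hl', le_rfl⟩ ?_
    · intro a ha b hb
      rw [show j + 1 - i = j - i + 1 by omega]
      rw [blockEdge_of_lt (by omega), Set.Icc_union_Icc_eq_Icc hl' hl] at this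
      obtain ⟨t, ht, hp⟩ := this a ha b hb
      refine ⟨t, ht, hp.mono le_rfl ?_⟩
      rintro e (rfl | ⟨t, ht, rfl⟩)
      · exact ⟨j, by omega, (blockEdge_of_lt (by omega)).symm⟩
      · exact ⟨t, by omega, rfl⟩
    · rintro ⟨t, ht, h⟩
      have := blockEdge_injective (by omega) h
      omega
    · rw [blockEdge_of_lt (by omega)]
      exact ⟨le_rfl, hl⟩

/-- The second conjunct drives the induction: all vertices are within ⌈d/2⌉ of the centre, so a
vertex of a new pendant edge is within ⌈d/2⌉ + 1 ≤ d of every old one. -/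
theorem pathConn_pathWithPendants {m d k : ℕ} (hk : 2 ≤ k) (hd : 2 ≤ d) (hdm : d ≤ m) {n : ℕ}
    (hdn : d ≤ n) (hnm : n ≤ m) :
    (pathWithPendants m d k).PathConn (Set.Iic ((k - 1) * n))
      {e | ∃ t < n, e = blockEdge d (k - 1) t} d ∧
    ∀ a ∈ Set.Iic ((k - 1) * n), ∃ t ≤ d - d / 2, (pathWithPendants m d k).PathIn
      (Set.Iic ((k - 1) * n)) {e | ∃ t < n, e = blockEdge d (k - 1) t} a ((k - 1) * (d / 2)) t := by
  induction n, hdn using Nat.le_induction with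
  | base =>
    have hle : (k - 1) * (d / 2) ≤ (k - 1) * d := Nat.mul_le_mul_left _ (by omega)
    constructor
    · have := pathConn_spine hk hdm (Nat.zero_le d) le_rfl
      rwa [mul_zero, Nat.sub_zero, ← Nat.bot_eq_zero, Set.Icc_bot] at this
    · intro a ha
      rcases le_total a ((k - 1) * (d / 2)) with h | h
      · obtain ⟨t, ht, hp⟩ := pathConn_spine hk hdm (Nat.zero_le (d / 2)) (by omega) a
          ⟨by simp, h⟩ _ ⟨by simp, le_rfl⟩
        refine ⟨t, by omega, hp.mono (fun x hx => hx.2.trans hle) ?_⟩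
        rintro e ⟨t, ht, rfl⟩
        exact ⟨t, by omega, rfl⟩
      · obtain ⟨t, ht, hp⟩ := pathConn_spine hk hdm (show d / 2 ≤ d by omega) le_rfl a
          ⟨h, ha⟩ _ ⟨le_rfl, hle⟩
        exact ⟨t, ht, hp.mono (fun x hx => hx.2) le_rfl⟩
  | succ n hdn ih =>
    obtain ⟨ih1, ih2⟩ := ih (by omega)
    set f := blockEdge d (k - 1) n with hfdef
    have hf : f ∈ (pathWithPendants m d k).edgeSet :=
      (mem_edgeSet_pathWithPendants hdm).2 ⟨n, by omega, rfl⟩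
    have hsub : Set.Iic ((k - 1) * n) ⊆ Set.Iic ((k - 1) * (n + 1)) :=
      Set.Iic_subset_Iic.2 (Nat.mul_le_mul_left _ (by omega))
    have hbase : (k - 1) * (d / 2) ≤ (k - 1) * n := Nat.mul_le_mul_left _ (by omega)
    have hpf : (k - 1) * (d / 2) ∈ f := by
      rw [hfdef, blockEdge_of_le hdn]
      exact Set.mem_insert _ _
    have hfsub : f ⊆ Set.Iic ((k - 1) * (n + 1)) := by
      rw [hfdef, blockEdge_of_le hdn]
      rintro x (rfl | hx)
      · exact hsub hbase
      · exact hx.2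
    have hE : {e | ∃ t < n, e = blockEdge d (k - 1) t} ⊆
        {e | ∃ t < n + 1, e = blockEdge d (k - 1) t} := by
      rintro e ⟨t, ht, rfl⟩
      exact ⟨t, by omega, rfl⟩
    have hfE' : f ∈ {e | ∃ t < n + 1, e = blockEdge d (k - 1) t} := ⟨n, by omega, rfl⟩
    have hfE : f ∉ {e | ∃ t < n, e = blockEdge d (k - 1) t} := by
      rintro ⟨t, ht, h⟩
      have := blockEdge_injective (by omega) h
      omega
    have hnew : ∀ x ∈ Set.Iic ((k - 1) * (n + 1)), x ∉ Set.Iic ((k - 1) * n) → x ∈ f := by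
      intro x hx hx'
      rw [hfdef, blockEdge_of_le hdn]
      exact Set.mem_insert_of_mem _ ⟨not_le.1 hx', hx⟩
    have hedge : ∀ a ∈ f, ∀ b ∈ f, ∃ t ≤ 1, (pathWithPendants m d k).PathIn
        (Set.Iic ((k - 1) * (n + 1))) {e | ∃ t < n + 1, e = blockEdge d (k - 1) t} a b t := by
      intro a ha b hb
      obtain ⟨t, ht, hp⟩ := pathConn_edge hf a ha b hb
      exact ⟨t, ht, hp.mono hfsub (by simpa using hfE')⟩
    have key : ∀ a ∈ Set.Iic ((k - 1) * n), ∀ z ∈ f, z ∉ Set.Iic ((k - 1) * n) →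
        ∃ t ≤ d, (pathWithPendants m d k).PathIn
          (Set.Iic ((k - 1) * (n + 1))) {e | ∃ t < n + 1, e = blockEdge d (k - 1) t} a z t := by
      intro a ha z hz hzW
      obtain ⟨t, ht, hp⟩ := ih2 a ha
      exact ⟨t + 1, by omega, (hp.snoc hf hfE hpf hz hzW).mono (Set.union_subset hsub hfsub)
        (Set.insert_subset hfE' hE)⟩
    constructor
    · intro a ha b hb
      by_cases ha' : a ∈ Set.Iic ((k - 1) * n) <;> by_cases hb' : b ∈ Set.Iic ((k - 1) * n)
      · obtain ⟨t, ht, hp⟩ := ih1 a ha' b hb'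
        exact ⟨t, ht, hp.mono hsub hE⟩
      · exact key a ha' b (hnew b hb hb') hb'
      · obtain ⟨t, ht, hp⟩ := key b hb' a (hnew a ha ha') ha'
        exact ⟨t, ht, hp.symm⟩
      · obtain ⟨t, ht, hp⟩ := hedge a (hnew a ha ha') b (hnew b hb hb')
        exact ⟨t, by omega, hp⟩
    · intro a ha
      by_cases ha' : a ∈ Set.Iic ((k - 1) * n)
      · obtain ⟨t, ht, hp⟩ := ih2 a ha'
        exact ⟨t, ht, hp.mono hsub hE⟩
      · obtain ⟨t, ht, hp⟩ := hedge a (hnew a ha ha') _ hpf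
        exact ⟨t, by omega, hp⟩

/-- The number of spine edges between `0` and the spine edge at which the vertex `x` lies. -/
def spineLevel (d K x : ℕ) : ℕ := if x ≤ K * d then (x + (K - 1)) / K else d / 2

/-- The level is `j` or `j + 1` on the `j`-th spine edge and constant on a pendant edge. -/
theorem spineLevel_le {d K j : ℕ} (hK : 1 ≤ K) {a b : ℕ} (ha : a ∈ blockEdge d K j)
    (hb : b ∈ blockEdge d K j) : spineLevel d K b ≤ spineLevel d K a + 1 := by
  by_cases hj : j < d
  · rw [blockEdge_of_lt hj] at ha hb
    have hl : K * (j + 1) ≤ K * d := Nat.mul_le_mul_left _ hj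
    rw [spineLevel, spineLevel, if_pos (hb.2.trans hl), if_pos (ha.2.trans hl)]
    have h1 : j ≤ (a + (K - 1)) / K := by
      rw [Nat.le_div_iff_mul_le (by omega), mul_comm]
      have := ha.1
      omega
    have h2 : (b + (K - 1)) / K < j + 2 := by
      rw [Nat.div_lt_iff_lt_mul (by omega), mul_comm]
      have := hb.2
      have : K * (j + 2) = K * (j + 1) + K := by ring
      omega
    omega
  · have hval : ∀ x ∈ blockEdge d K j, spineLevel d K x = d / 2 := by
      rw [blockEdge_of_le (by omega)]
      rintro x (rfl | hx)
      · rw [spineLevel, if_pos (Nat.mul_le_mul_left _ (Nat.div_le_self d 2)),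
          Nat.mul_add_div (by omega), Nat.div_eq_of_lt (a := K - 1) (by omega), add_zero]
      · rw [spineLevel, if_neg]
        have : K * d ≤ K * j := Nat.mul_le_mul_left _ (by omega)
        have := hx.1
        omega
    rw [hval a ha, hval b hb]
    omega

/-- The level has to rise from 0 to `d`, by at most one per edge. -/
theorem le_of_hasPath_pathWithPendants {m d k : ℕ} (hk : 2 ≤ k) (hdm : d ≤ m) {s : ℕ}
    (h : (pathWithPendants m d k).HasPath 0 ((k - 1) * d) s) : d ≤ s := by
  obtain ⟨v, e, ⟨⟨-, he⟩, -⟩, h0, hl⟩ := h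
  have key : ∀ i, spineLevel d (k - 1) (v i) ≤ i := by
    intro i
    induction i using Fin.induction with
    | zero =>
      rw [h0, spineLevel, if_pos (Nat.zero_le _), Nat.div_eq_of_lt (by omega)]
      simp
    | succ i ih =>
      obtain ⟨h1, h2, h3, -⟩ := he i
      obtain ⟨j, -, hj⟩ := (mem_edgeSet_pathWithPendants hdm).1 h1
      rw [hj] at h2 h3
      have := spineLevel_le (by omega) h2 h3
      simp only [Fin.val_castSucc, Fin.val_succ] at ih ⊢
      omega
  have := key (Fin.last s)
  rw [hl, spineLevel, if_pos le_rfl, Nat.mul_add_div (by omega), Nat.div_eq_of_lt (by omega)]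
    at this
  simpa using this

theorem pathWithPendants_isUniformHypertree {m d k : ℕ} (hk : 2 ≤ k) (hd : 2 ≤ d) (hdm : d ≤ m) :
    (pathWithPendants m d k).IsUniformHypertree k m d := by
  have hpath : ∀ u ∈ (pathWithPendants m d k).vertexSet,
      ∀ w ∈ (pathWithPendants m d k).vertexSet, ∃ s ≤ d, (pathWithPendants m d k).HasPath u w s := by
    intro u hu w hw
    rw [vertexSet_pathWithPendants hdm] at hu hw
    obtain ⟨t, ht, hp⟩ := (pathConn_pathWithPendants hk hd hdm hdm le_rfl).1 u hu w hw
    exact ⟨t, ht, hp.hasPath⟩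
  have h0 : 0 ∈ (pathWithPendants m d k).vertexSet := by
    rw [vertexSet_pathWithPendants hdm]
    exact Nat.zero_le _
  have h1 : (k - 1) * d ∈ (pathWithPendants m d k).vertexSet := by
    rw [vertexSet_pathWithPendants hdm]
    exact Nat.mul_le_mul_left _ hdm
  refine ⟨?_, ⟨⟨⟨0, h0⟩, fun u hu w hw => ?_⟩, fun s v e => ?_⟩, ?_,
    ncard_edgeSet_pathWithPendants hk hdm, ⟨0, h0, _, h1, ?_⟩, ?_⟩
  · intro e he
    obtain ⟨j, -, rfl⟩ := (mem_edgeSet_pathWithPendants hdm).1 he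
    exact ⟨finite_blockEdge, by rw [ncard_blockEdge]; omega⟩
  · obtain ⟨s, -, h⟩ := hpath u hu w hw
    exact ⟨s, h⟩
  · refine not_isCycle_of_level (r := sInf) id ?_ ?_
    · intro e he w hw hne
      exact lt_of_le_of_ne (Nat.sInf_le hw) hne.symm
    · intro e he f hf w hwe hwr hwf hwr'
      obtain ⟨i, -, rfl⟩ := (mem_edgeSet_pathWithPendants hdm).1 he
      obtain ⟨j, -, rfl⟩ := (mem_edgeSet_pathWithPendants hdm).1 hf
      rw [eq_of_mem_block (mem_Ioc_of_mem_blockEdge hwe hwr) (mem_Ioc_of_mem_blockEdge hwf hwr')]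
  · rw [edgeSet_pathWithPendants hdm]
    exact (Set.finite_Iio m).image _
  · obtain ⟨s, hs, h⟩ := hpath 0 h0 _ h1
    refine le_antisymm ((Nat.sInf_le h).trans hs) ?_
    exact le_of_hasPath_pathWithPendants hk hdm
      (Nat.sInf_mem (s := {s | (pathWithPendants m d k).HasPath 0 ((k - 1) * d) s}) ⟨s, h⟩)
  · rintro _ ⟨u, hu, w, hw, rfl⟩
    obtain ⟨s, hs, h⟩ := hpath u hu w hw
    exact (Nat.sInf_le h).trans hs

end Hypergraph

/-! ### Recognising `pathWithPendants` up to isomorphism -/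

namespace Hypergraph

variable {V : Type*} {G : Hypergraph V}

theorem isIsomorphic_of_bijOn {W : Type*} {H : Hypergraph W} {ψ : V → W}
    (hψ : Set.BijOn ψ G.vertexSet H.vertexSet)
    (hE : H.edgeSet = (fun e => ψ '' e) '' G.edgeSet) : G.IsIsomorphic H := by
  refine ⟨Set.BijOn.equiv ψ hψ, fun s => ?_⟩
  have himg : Subtype.val '' (Set.BijOn.equiv ψ hψ '' s) = ψ '' (Subtype.val '' s) := by
    rw [Set.image_image, Set.image_image]
    rfl
  rw [himg, hE]
  constructor
  · intro hs
    exact ⟨_, hs, rfl⟩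
  · rintro ⟨e, he, h⟩
    have := (hψ.injOn.image_eq_image_iff (G.subset_vertexSet_of_mem_edgeSet' he)
      (Subtype.coe_image_subset _ s)).1 h
    rwa [← this]

/-- A transposition corrects one value of an arbitrary bijection. The condition `P` is there because
a value is prescribed only for edges of the path. -/
theorem exists_bijOn_of_ncard_eq {A B : Type*} [Nonempty B] {s : Set A} {t : Set B}
    (hs : s.Finite) (ht : t.Finite) (h : s.ncard = t.ncard) {P : Prop} {a : A} {b : B}
    (ha : P → a ∈ s) (hb : P → b ∈ t) : ∃ f : A → B, Set.BijOn f s t ∧ (P → f a = b) := by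
  classical
  obtain ⟨f, hf⟩ := hs.exists_bijOn_of_encard_eq (t := t) (by
    rw [← hs.cast_ncard_eq, ← ht.cast_ncard_eq, h])
  by_cases hP : P
  · refine ⟨Equiv.swap (f a) b ∘ f, Set.BijOn.comp (Equiv.swap_bijOn_self ?_) hf, fun _ => by simp⟩
    simp [hf.mapsTo (ha hP), hb hP]
  · exact ⟨f, hf, fun h => absurd h hP⟩

theorem exists_enumeration {A : Type*} [Nonempty A] {S : Set A} (hS : S.Finite) {d : ℕ}
    {e : Fin d → A} (he : Function.Injective e) (heS : ∀ j, e j ∈ S) :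
    d ≤ S.ncard ∧ ∃ E : ℕ → A, Set.BijOn E (Set.Iio S.ncard) S ∧ ∀ j : Fin d, E j = e j := by
  classical
  have hcr : (Set.range e).ncard = d := by
    rw [← Set.image_univ, Set.ncard_image_of_injective _ he, Set.ncard_univ, Nat.card_fin]
  have hsub : Set.range e ⊆ S := Set.range_subset_iff.2 heS
  have hdm : d ≤ S.ncard := hcr ▸ Set.ncard_le_ncard hsub hS
  refine ⟨hdm, ?_⟩
  have hcd : (S \ Set.range e).ncard = S.ncard - d := by
    rw [Set.ncard_sdiff hsub (Set.finite_range _), hcr]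
  obtain ⟨f, hf, -⟩ := exists_bijOn_of_ncard_eq (s := Set.Ico d S.ncard) (Set.finite_Ico _ _)
    (hS.subset Set.sdiff_subset) (t := S \ Set.range e) (by
      rw [hcd, ← Finset.coe_Ico, Set.ncard_coe_finset, Nat.card_Ico]) (P := False) (a := 0)
    (b := Classical.arbitrary A) False.elim False.elim
  set E : ℕ → A := fun j => if h : j < d then e ⟨j, h⟩ else f j with hE
  have hlt : ∀ j (h : j < d), E j = e ⟨j, h⟩ := fun j h => by simp [hE, h]
  have hge : ∀ j, d ≤ j → E j = f j := fun j h => by simp [hE, not_lt.2 h]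
  refine ⟨E, ⟨fun j hj => ?_, fun i hi j hj hij => ?_, fun x hx => ?_⟩, fun j => by simp [hE]⟩
  · by_cases h : j < d
    · rw [hlt j h]; exact heS _
    · rw [hge j (by omega)]; exact (hf.mapsTo ⟨by omega, hj⟩).1
  · by_cases h : i < d <;> by_cases h' : j < d
    · rw [hlt i h, hlt j h'] at hij
      simpa using he hij
    · rw [hlt i h, hge j (by omega)] at hij
      exact absurd ⟨_, hij⟩ (hf.mapsTo ⟨by omega, hj⟩).2
    · rw [hge i (by omega), hlt j h'] at hij
      exact absurd ⟨_, hij.symm⟩ (hf.mapsTo ⟨by omega, hi⟩).2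
    · rw [hge i (by omega), hge j (by omega)] at hij
      exact hf.injOn ⟨by omega, hi⟩ ⟨by omega, hj⟩ hij
  · by_cases hxe : x ∈ Set.range e
    · obtain ⟨j, rfl⟩ := hxe
      exact ⟨j, j.2.trans_le hdm, hlt j j.2⟩
    · obtain ⟨j, hj, rfl⟩ := hf.surjOn ⟨hx, hxe⟩
      exact ⟨j, hj.2, hge j hj.1⟩

/-- `(v, e)` is a path of length `d`, and all the other edges contain its vertex `v_{⌊d/2⌋}`. -/
structure IsBroomPath (G : Hypergraph V) (d : ℕ) (v : Fin (d + 1) → V) (e : Fin d → Set V) :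
    Prop where
  isPath : G.IsPath d v e
  mem_of_ne : ∀ f ∈ G.edgeSet, (∀ j, f ≠ e j) → v ⟨d / 2, by omega⟩ ∈ f

theorem IsBroomPath.isIsomorphic {k d : ℕ} {v : Fin (d + 1) → V} {e : Fin d → Set V}
    (h : G.IsBroomPath d v e) (hk : 2 ≤ k) (hd : 2 ≤ d) (hG : G.IsHypertree) (hu : G.IsUniform k)
    (hfin : G.edgeSet.Finite) : G.IsIsomorphic (pathWithPendants G.edgeSet.ncard d k) := by
  classical
  have hne : ∀ e ∈ G.edgeSet, e.Nonempty := fun e he => by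
    rw [← Set.ncard_pos (hu e he).1, (hu e he).2]; omega
  have hpath := h.isPath
  -- Rooted at its own end, the path only moves away from the root, so `v j` is the nearest vertex
  -- of `e j`.
  obtain ⟨r, hr⟩ := hG.exists_isRooting hfin hne (hpath.1.1 0)
  have hrE : ∀ j : Fin d, r (e j) = v j.castSucc := by
    obtain ⟨i, hi, h1, -, h3⟩ := hr.exists_turn hpath
    have : i = 0 := by
      by_contra hi0
      refine h1 ⟨0, by omega⟩ (Nat.pos_of_ne_zero hi0) ?_
      exact (hr.root _ (hpath.1.2 _).1 (hpath.1.2 ⟨0, by omega⟩).2.1).symm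
    exact fun j => h3 j (by omega)
  have hchild : ∀ j : Fin d, v j.succ ∈ e j ∧ v j.succ ≠ r (e j) := fun j =>
    ⟨(hpath.1.2 j).2.2.1, hrE j ▸ (hpath.1.2 j).2.2.2.symm⟩
  -- The middle vertex is already a child in the path edge before it, so it is not a child in `f`.
  have hrf : ∀ f ∈ G.edgeSet, (∀ j, f ≠ e j) → r f = v ⟨d / 2, by omega⟩ := by
    intro f hf hfe
    by_contra hcon
    have hj := hchild ⟨d / 2 - 1, by omega⟩
    have heq : (Fin.succ ⟨d / 2 - 1, by omega⟩ : Fin (d + 1)) = ⟨d / 2, by omega⟩ :=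
      Fin.ext (by simp; omega)
    rw [heq] at hj
    exact hfe _ (hr.child_unique _ hf _ (hpath.1.2 _).1 _ (h.mem_of_ne f hf hfe) (Ne.symm hcon)
      hj.1 hj.2)
  obtain ⟨hdm, E, hE, hEe⟩ := exists_enumeration hfin hpath.2.2 (fun j => (hpath.1.2 j).1)
  set m := G.edgeSet.ncard with hm
  have hEm : ∀ j < m, E j ∈ G.edgeSet := fun j hj => hE.mapsTo hj
  have hlt : ∀ j (hj : j < d), E j = e ⟨j, hj⟩ := fun j hj => hEe ⟨j, hj⟩
  have hrE' : ∀ j < m, ∃ i : Fin (d + 1), r (E j) = v i ∧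
      i.val = (if j < d then j else d / 2) := by
    intro j hj
    by_cases hjd : j < d
    · exact ⟨Fin.castSucc ⟨j, hjd⟩, by rw [hlt j hjd, hrE], by simp [hjd]⟩
    · refine ⟨⟨d / 2, by omega⟩, hrf _ (hEm j hj) fun i hi => ?_, by simp [hjd]⟩
      have := hE.injOn (x₁ := j) (x₂ := i) hj (i.2.trans_le hdm) (hi.trans (hEe i).symm)
      omega
  -- The children in the `j`-th edge are matched with the `j`-th block of `k - 1` numbers. A path
  -- vertex goes to the last number of its block, where the next spine edge begins.
  have hσ : ∀ j, ∃ σ : V → ℕ, j < m →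
      Set.BijOn σ (E j \ {r (E j)}) (Set.Ioc ((k - 1) * j) ((k - 1) * (j + 1))) ∧
      ∀ hj : j < d, σ (v (Fin.succ ⟨j, hj⟩)) = (k - 1) * (j + 1) := by
    intro j
    by_cases hj : j < m
    · have hcard : (E j \ {r (E j)}).ncard =
          (Set.Ioc ((k - 1) * j) ((k - 1) * (j + 1))).ncard := by
        rw [Set.ncard_sdiff_singleton_of_mem (hr.mem _ (hEm j hj)), (hu _ (hEm j hj)).2,
          ← Finset.coe_Ioc, Set.ncard_coe_finset, Nat.card_Ioc, mul_add]
        omega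
      have hfinj := ((hu _ (hEm j hj)).1.subset (Set.sdiff_subset (t := {r (E j)})))
      obtain ⟨σ, hσ, hσ'⟩ := exists_bijOn_of_ncard_eq hfinj (Set.finite_Ioc _ _) hcard
        (P := j < d) (a := if hj : j < d then v (Fin.succ ⟨j, hj⟩) else v 0)
        (b := (k - 1) * (j + 1)) (fun hjd => by
          rw [dif_pos hjd, hlt j hjd]; exact hchild _)
        (fun _ => ⟨by rw [mul_add]; omega, le_rfl⟩)
      exact ⟨σ, fun _ => ⟨hσ, fun hjd => by simpa [hjd] using hσ' hjd⟩⟩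
    · exact ⟨fun _ => 0, fun h => absurd h hj⟩
  choose σ hσ using hσ
  have hidx : ∀ w, ∃ j, w ∈ G.vertexSet → w ≠ v 0 → j < m ∧ w ∈ E j \ {r (E j)} := by
    intro w
    by_cases hw : w ∈ G.vertexSet ∧ w ≠ v 0
    · obtain ⟨f, hf, hwf, hwr⟩ := hr.exists_child w hw.1 hw.2
      obtain ⟨j, hj, rfl⟩ := hE.surjOn hf
      exact ⟨j, fun _ _ => ⟨hj, hwf, hwr⟩⟩
    · exact ⟨0, fun h1 h2 => absurd ⟨h1, h2⟩ hw⟩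
  choose idx hidx using hidx
  have hroot : ∀ j < m, v 0 ∉ E j \ {r (E j)} := fun j hj hmem =>
    hmem.2 (hr.root _ (hEm j hj) hmem.1).symm
  set ψ : V → ℕ := fun w => if w = v 0 then 0 else σ (idx w) w with hψ
  have hψ0 : ψ (v 0) = 0 := by simp [hψ]
  have hψσ : ∀ j < m, ∀ w ∈ E j \ {r (E j)}, ψ w = σ j w := by
    intro j hj w hw
    have hw0 : w ≠ v 0 := fun h => hroot j hj (h ▸ hw)
    obtain ⟨h1, h2⟩ := hidx w (G.subset_vertexSet_of_mem_edgeSet' (hEm j hj) hw.1) hw0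
    have : idx w = j := hE.injOn h1 hj
      (hr.child_unique _ (hEm _ h1) _ (hEm j hj) w h2.1 h2.2 hw.1 hw.2)
    simp only [hψ, if_neg hw0, this]
  have hψI : ∀ j < m, ∀ w ∈ E j \ {r (E j)}, ψ w ∈ Set.Ioc ((k - 1) * j) ((k - 1) * (j + 1)) :=
    fun j hj w hw => hψσ j hj w hw ▸ (hσ j hj).1.mapsTo hw
  have hψv : ∀ i : Fin (d + 1), ψ (v i) = (k - 1) * i := by
    intro i
    induction i using Fin.cases with
    | zero => simpa using hψ0
    | succ i =>
      have hi : i.val < m := i.2.trans_le hdm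
      rw [hψσ i hi _ (by rw [hEe]; exact hchild i), (hσ i hi).2 i.2]
      simp
  have hbij : Set.BijOn ψ G.vertexSet (pathWithPendants m d k).vertexSet := by
    rw [vertexSet_pathWithPendants hdm]
    refine ⟨fun w hw => ?_, fun w hw w' hw' heq => ?_, fun x hx => ?_⟩
    · by_cases hw0 : w = v 0
      · rw [hw0, hψ0]; exact Nat.zero_le _
      · obtain ⟨h1, h2⟩ := hidx w hw hw0
        exact (hψI _ h1 w h2).2.trans (Nat.mul_le_mul_left _ h1)
    · by_cases hw0 : w = v 0 <;> by_cases hw0' : w' = v 0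
      · rw [hw0, hw0']
      · obtain ⟨h1, h2⟩ := hidx w' hw' hw0'
        have := (hψI _ h1 w' h2).1
        rw [← heq, hw0, hψ0] at this
        omega
      · obtain ⟨h1, h2⟩ := hidx w hw hw0
        have := (hψI _ h1 w h2).1
        rw [heq, hw0', hψ0] at this
        omega
      · obtain ⟨h1, h2⟩ := hidx w hw hw0
        obtain ⟨h1', h2'⟩ := hidx w' hw' hw0'
        have hii := eq_of_mem_block (hψI _ h1 w h2) (heq ▸ hψI _ h1' w' h2')
        rw [← hii] at h2'
        rw [hψσ _ h1 w h2, hψσ _ h1 w' h2'] at heq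
        exact (hσ _ h1).1.injOn h2 h2' heq
    · rcases Nat.eq_zero_or_pos x with rfl | hx0
      · exact ⟨v 0, hpath.1.1 0, hψ0⟩
      · have hmod := Nat.div_add_mod (x - 1) (k - 1)
        have hml := Nat.mod_lt (x - 1) (show 0 < k - 1 by omega)
        set j := (x - 1) / (k - 1)
        have hxj : x ∈ Set.Ioc ((k - 1) * j) ((k - 1) * (j + 1)) :=
          ⟨by omega, by rw [mul_add]; omega⟩
        have hj : j < m := lt_of_mul_lt_mul_left (hxj.1.trans_le hx) (Nat.zero_le _)
        obtain ⟨w, hw, hwx⟩ := (hσ j hj).1.surjOn hxj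
        exact ⟨w, G.subset_vertexSet_of_mem_edgeSet' (hEm j hj) hw.1,
          (hψσ j hj w hw).trans hwx⟩
  have himg : ∀ j < m, ψ '' E j = blockEdge d (k - 1) j := by
    intro j hj
    obtain ⟨i, hi1, hi2⟩ := hrE' j hj
    have hEj : E j = insert (r (E j)) (E j \ {r (E j)}) := by
      rw [Set.insert_sdiff_singleton, Set.insert_eq_of_mem (hr.mem _ (hEm j hj))]
    rw [hEj, Set.image_insert_eq, hi1, hψv, hi2, ← hi1, blockEdge, ← (hσ j hj).1.image_eq]
    exact congrArg _ (Set.image_congr fun w hw => hψσ j hj w hw)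
  refine isIsomorphic_of_bijOn hbij ?_
  rw [edgeSet_pathWithPendants hdm, ← hE.image_eq, Set.image_image]
  exact (Set.image_congr fun j hj => himg j hj).symm

end Hypergraph

/-! ### Labels along a path and the balance equation -/

/-- The intermediate value theorem for the minimum of the functions. -/
theorem exists_first_contact {ι : Type*} [Finite ι] [Nonempty ι] {f : ι → ℝ → ℝ} {a b : ℝ}
    (hab : a ≤ b) (hf : ∀ i, ContinuousOn (f i) (Set.Icc a b)) (ha : ∃ i, f i a ≤ 0)
    (hb : ∀ i, 0 < f i b) :
    ∃ c ∈ Set.Icc a b, (∀ i, 0 ≤ f i c) ∧ ∃ i, f i c = 0 := by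
  classical
  have := Fintype.ofFinite ι
  set F : ℝ → ℝ := fun x => Finset.univ.inf' Finset.univ_nonempty fun i => f i x with hF
  have hFc : ContinuousOn F (Set.Icc a b) :=
    ContinuousOn.finset_inf'_apply Finset.univ_nonempty fun i _ => hf i
  obtain ⟨i, hi⟩ := ha
  obtain ⟨c, hc, hc0⟩ := intermediate_value_Icc hab hFc
    (show (0 : ℝ) ∈ Set.Icc (F a) (F b) from
      ⟨(Finset.inf'_le _ (Finset.mem_univ i)).trans hi,
        (Finset.le_inf'_iff _ _).2 fun i _ => (hb i).le⟩)
  refine ⟨c, hc, fun i => hc0 ▸ Finset.inf'_le _ (Finset.mem_univ i), ?_⟩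
  obtain ⟨j, -, hj⟩ := Finset.exists_mem_eq_inf' Finset.univ_nonempty fun i => f i c
  exact ⟨j, hj.symm.trans hc0⟩

/-- The total label, at its root, of a pendant path with `j` edges: with `c = ρ - α`, these are the
labels for which the edge products are constant and all other vertices have total label `ρ`. -/
noncomputable def branchLabel (α K c : ℝ) : ℕ → ℝ
  | 0 => 0
  | j + 1 => α + K / (c - branchLabel α K c j)

/-- The polynomials with `c - branchLabel α K c j = branchPoly α K c (j + 1) / branchPoly α K c j`. -/
noncomputable def branchPoly (α K c : ℝ) : ℕ → ℝ
  | 0 => 1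
  | 1 => c
  | j + 2 => (c - α) * branchPoly α K c (j + 1) - K * branchPoly α K c j

/-- This replaces the conditions g_j < c by positivity of polynomials, which remain continuous where
the labels have poles. -/
theorem sub_branchLabel {α K c : ℝ} {q : ℕ} (h : ∀ j ≤ q, 0 < branchPoly α K c j) :
    ∀ j < q, c - branchLabel α K c j = branchPoly α K c (j + 1) / branchPoly α K c j := by
  intro j hj
  induction j with
  | zero => simp [branchLabel, branchPoly]
  | succ j ih =>
    have h1 := h j (by omega)
    have h2 := h (j + 1) (by omega)
    rw [branchLabel, ih (by omega), branchPoly]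
    field_simp
    ring

theorem branchLabel_succ_eq {α K c : ℝ} {q : ℕ} (h : ∀ j ≤ q, 0 < branchPoly α K c j)
    {j : ℕ} (hj : j < q) :
    branchLabel α K c (j + 1) = α + K * branchPoly α K c j / branchPoly α K c (j + 1) := by
  have h1 := h j (by omega)
  have h2 := h (j + 1) (by omega)
  rw [branchLabel, sub_branchLabel h j hj]
  field_simp

theorem continuousOn_branchPoly {α : ℝ} {K : ℝ → ℝ} {s : Set ℝ} (hK : ContinuousOn K s) (j : ℕ) :
    ContinuousOn (fun c => branchPoly α (K c) c j) s := by
  induction j using Nat.twoStepInduction with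
  | zero => exact continuousOn_const
  | one => exact continuousOn_id
  | more j h1 h2 =>
    exact ((continuousOn_id.sub continuousOn_const).mul h2).sub (hK.mul h1)

theorem branchPoly_large {α K c : ℝ} (hα1 : α < 1) (hK1 : K ≤ 1) (hc : 4 ≤ c)
    (j : ℕ) : 0 < branchPoly α K c j ∧ 2 * branchPoly α K c j ≤ branchPoly α K c (j + 1) := by
  induction j with
  | zero => simp only [branchPoly]; constructor <;> linarith
  | succ j ih =>
    obtain ⟨h1, h2⟩ := ih
    refine ⟨by linarith, ?_⟩
    rw [branchPoly]
    nlinarith [mul_nonneg (sub_nonneg.2 hK1) h1.le]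

theorem branchPoly_small {α K c : ℝ} (hα0 : 0 ≤ α) (hK0 : 0 ≤ K) {q : ℕ}
    (h : ∀ j ≤ q, 0 < branchPoly α K c j) {j : ℕ} (hj : j < q) :
    branchPoly α K c (j + 1) ≤ c * branchPoly α K c j := by
  rcases j with _ | j
  · simp [branchPoly]
  · rw [branchPoly]
    nlinarith [mul_nonneg hα0 (h (j + 1) (by omega)).le, mul_nonneg hK0 (h j (by omega)).le]

/-- With K determined by c, the equation becomes E = 0 after clearing denominators. The functions
Q_j and D are carried along to justify dividing: the minimum of all these functions changes sign
between 1 − α and 2n + 4, and where it vanishes neither D nor any Q_j can be zero, so E is. -/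
theorem exists_branchLabel_balance {α : ℝ} (hα0 : 0 ≤ α) (hα1 : α < 1) (r p q n : ℕ)
    (hpq : p ≤ q) :
    ∃ c K : ℝ, 0 < c ∧ 0 < K ∧ K * c ^ r = (1 - α) ^ (r + 2) ∧
      (∀ j ≤ q, branchLabel α K c j < c) ∧
      branchLabel α K c (p + 1) + branchLabel α K c (q + 1) + n * branchLabel α K c 1 = c + α := by
  have hβ : 0 < 1 - α := by linarith
  set K : ℝ → ℝ := fun c => (1 - α) ^ (r + 2) / c ^ r with hKdef
  set a := 1 - α
  set b : ℝ := 2 * n + 4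
  have hn0 : (0 : ℝ) ≤ n := Nat.cast_nonneg n
  have hab : a ≤ b := by simp only [a, b]; linarith
  have hKpos : ∀ c, 0 < c → 0 < K c := fun c hc => by simp only [hKdef]; positivity
  have hIcc : ∀ c ∈ Set.Icc a b, c ≠ 0 := fun c hc => (hβ.trans_le hc.1).ne'
  have hKc : ContinuousOn K (Set.Icc a b) :=
    continuousOn_const.div (continuousOn_id.pow r) fun c hc => pow_ne_zero _ (hIcc c hc)
  set Q : ℕ → ℝ → ℝ := fun j c => branchPoly α (K c) c j with hQ
  have hQc : ∀ j, ContinuousOn (Q j) (Set.Icc a b) := continuousOn_branchPoly hKc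
  set L : ℝ → ℝ := fun c => c - α - n * (α + K c / c) with hL
  have hLc : ContinuousOn L (Set.Icc a b) :=
    (continuousOn_id.sub continuousOn_const).sub
      (continuousOn_const.mul (continuousOn_const.add (hKc.div continuousOn_id hIcc)))
  -- D / Q_{q+1} is what remains of c + α at the centre after the label α of the missing branch, the
  -- pendant edges and the branch of q + 1 edges; E / (Q_{p+1} Q_{q+1}) also subtracts the rest of
  -- the other branch.
  set D : ℝ → ℝ := fun c => L c * Q (q + 1) c - K c * Q q c with hD
  set E : ℝ → ℝ := fun c => Q (p + 1) c * D c - K c * (Q p c * Q (q + 1) c) with hE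
  have hDc : ContinuousOn D (Set.Icc a b) := (hLc.mul (hQc _)).sub (hKc.mul (hQc _))
  have hEc : ContinuousOn E (Set.Icc a b) :=
    ((hQc _).mul hDc).sub (hKc.mul ((hQc _).mul (hQc _)))
  set f : Option (Option (Fin (q + 2))) → ℝ → ℝ := fun i => match i with
    | none => D
    | some none => E
    | some (some j) => Q j with hf
  have hfc : ∀ i, ContinuousOn (f i) (Set.Icc a b) := by
    intro i
    match i with
    | none => exact hDc
    | some none => exact hEc
    | some (some j) => exact hQc j
  -- At c = 1 − α we have K = c². If all Q_j are positive, then Q_{q+1} ≤ c Q_q, and together with L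
  -- ≤ c this makes D ≤ 0.
  have hfa : ∃ i, f i a ≤ 0 := by
    by_contra hcon
    push Not at hcon
    have hK2 : K a = a ^ 2 := by
      simp only [hKdef]
      field_simp
      ring
    have hQpos : ∀ j ≤ q + 1, 0 < Q j a := fun j hj => hcon (some (some ⟨j, by omega⟩))
    have hDpos : 0 < D a := hcon none
    have hDe : D a = (a - α - n * (α + K a / a)) * Q (q + 1) a - K a * Q q a := rfl
    have hs : Q (q + 1) a ≤ a * Q q a := branchPoly_small hα0 (hKpos a hβ).le hQpos (by omega)
    have hq1 := hQpos (q + 1) le_rfl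
    have : 0 ≤ n * (α + K a / a) * Q (q + 1) a := by
      have := hKpos a hβ
      positivity
    rw [hK2] at hDe this
    have h5 := mul_nonneg hα0 hq1.le
    have h6 : a * Q (q + 1) a ≤ a * (a * Q q a) := mul_le_mul_of_nonneg_left hs hβ.le
    nlinarith
  have hfb : ∀ i, 0 < f i b := by
    have hb4 : (4 : ℝ) ≤ b := by simp only [b]; linarith
    have hb0 : 0 < b := by linarith
    have hK1 : K b ≤ 1 := by
      simp only [hKdef]
      rw [div_le_one (by positivity)]
      exact (pow_le_one₀ hβ.le (by linarith)).trans (one_le_pow₀ (by linarith))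
    have hKb := hKpos b hb0
    have hlarge := branchPoly_large hα1 hK1 hb4
    have hQpos : ∀ j, 0 < Q j b := fun j => (hlarge j).1
    have hp1 := hQpos (p + 1)
    have hq1 := hQpos (q + 1)
    have hLb : 2 < L b := by
      have h1 : K b / b ≤ 1 := by rw [div_le_one hb0]; linarith
      have h2 : n * (α + K b / b) ≤ n * (1 + 1) :=
        mul_le_mul_of_nonneg_left (by linarith) hn0
      have : L b = b - α - n * (α + K b / b) := rfl
      simp only [b] at this ⊢
      linarith
    have hKQ : ∀ j, K b * Q j b ≤ Q (j + 1) b := fun j => by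
      have h1 : K b * Q j b ≤ 1 * Q j b := mul_le_mul_of_nonneg_right hK1 (hQpos j).le
      have h2 := hQpos j
      have h3 : 2 * Q j b ≤ Q (j + 1) b := (hlarge j).2
      linarith
    have hDb : Q (q + 1) b < D b := by
      have h1 := hKQ q
      have h2 : 2 * Q (q + 1) b < L b * Q (q + 1) b := mul_lt_mul_of_pos_right hLb hq1
      simp only [hD]
      linarith
    have hEb : 0 < E b := by
      have h1 := mul_lt_mul_of_pos_left hDb hp1
      have h2 := mul_le_mul_of_nonneg_right (hKQ p) hq1.le
      simp only [hE]
      linarith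
    intro i
    match i with
    | none => exact hq1.trans hDb
    | some none => exact hEb
    | some (some j) => exact hQpos j
  obtain ⟨c, hc, hnn, hz⟩ := exists_first_contact (f := f) hab hfc hfa hfb
  have hc0 : 0 < c := hβ.trans_le hc.1
  have hKc0 := hKpos c hc0
  have hD0 : 0 ≤ D c := hnn none
  have hE0 : 0 ≤ E c := hnn (some none)
  have hQ0 : ∀ j ≤ q + 1, 0 ≤ Q j c := fun j hj => hnn (some (some ⟨j, by omega⟩))
  have hQrec : ∀ j, Q (j + 2) c = (c - α) * Q (j + 1) c - K c * Q j c := fun j => rfl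
  -- After a first zero, the next polynomial (or D, if the zero is the last Q) would be negative.
  have hQpos' : ∀ j ≤ q, 0 < Q j c ∧ 0 < Q (j + 1) c := by
    intro j hj
    induction j with
    | zero => exact ⟨one_pos, hc0⟩
    | succ j ih =>
      obtain ⟨h1, h2⟩ := ih (by omega)
      refine ⟨h2, lt_of_le_of_ne (hQ0 _ (by omega)) fun h0 => ?_⟩
      have hKQ := mul_pos hKc0 h2
      rcases (show j + 1 = q ∨ j + 3 ≤ q + 1 by omega) with h | h
      · have hDe : D c = L c * Q (q + 1) c - K c * Q q c := rfl
        rw [← h, ← h0] at hDe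
        linarith
      · have h3 := hQrec (j + 1)
        rw [← h0] at h3
        have := hQ0 _ h
        linarith
  have hQpos : ∀ j ≤ q + 1, 0 < Q j c := fun j hj => by
    rcases j with _ | j
    · exact (hQpos' 0 (by omega)).1
    · exact (hQpos' j (by omega)).2
  have hp := hQpos p (by omega)
  have hp1 := hQpos (p + 1) (by omega)
  have hq := hQpos q (by omega)
  have hq1 := hQpos (q + 1) le_rfl
  have hEe : E c = Q (p + 1) c * D c - K c * (Q p c * Q (q + 1) c) := rfl
  have hDpos : 0 < D c := by
    have : 0 < K c * (Q p c * Q (q + 1) c) := by positivity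
    by_contra hcon
    nlinarith [mul_nonneg hp1.le (sub_nonneg.2 (not_lt.1 hcon))]
  have hEz : E c = 0 := by
    obtain ⟨i, hi⟩ := hz
    match i, hi with
    | none, hi => exact absurd hi hDpos.ne'
    | some none, hi => exact hi
    | some (some j), hi => exact absurd hi (hQpos j (by omega)).ne'
  refine ⟨c, K c, hc0, hKc0, ?_, fun j hj => ?_, ?_⟩
  · simp only [hKdef]
    field_simp
  · have h1 := sub_branchLabel hQpos j (by omega)
    have : 0 < Q (j + 1) c / Q j c := div_pos (hQpos _ (by omega)) (hQpos _ (by omega))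
    simp only [hQ] at this
    linarith
  · have e1 : branchLabel α (K c) c 1 = α + K c / c := by simp [branchLabel]
    have e2 : branchLabel α (K c) c (p + 1) = α + K c * Q p c / Q (p + 1) c :=
      branchLabel_succ_eq hQpos (by omega)
    have e3 : branchLabel α (K c) c (q + 1) = α + K c * Q q c / Q (q + 1) c :=
      branchLabel_succ_eq hQpos (by omega)
    have hDe : D c = (c - α - n * (α + K c / c)) * Q (q + 1) c - K c * Q q c := rfl
    rw [hDe] at hEe
    rw [e1, e2, e3]
    have h3 : K c * Q p c / Q (p + 1) c + K c * Q q c / Q (q + 1) c =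
        c - α - n * (α + K c / c) := by
      rw [div_add_div _ _ hp1.ne' hq1.ne', div_eq_iff (by positivity)]
      linarith
    linarith

/-! ### The best position of the root on a path -/

section Balance

variable {α K c : ℝ}

theorem branchLabel_succ_mul {j : ℕ} (hj : branchLabel α K c j < c) :
    (branchLabel α K c (j + 1) - α) * (c - branchLabel α K c j) = K := by
  rw [branchLabel, add_sub_cancel_left, div_mul_cancel₀]
  linarith

theorem alpha_lt_branchLabel (hK : 0 < K) {j : ℕ} (hj : branchLabel α K c j < c) :
    α < branchLabel α K c (j + 1) := by
  rw [branchLabel]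
  have : 0 < K / (c - branchLabel α K c j) := div_pos hK (by linarith)
  linarith

theorem branchLabel_lt_succ (hα : 0 ≤ α) (hK : 0 < K) {j : ℕ}
    (h : ∀ i ≤ j, branchLabel α K c i < c) :
    branchLabel α K c j < branchLabel α K c (j + 1) := by
  induction j with
  | zero =>
    have h0 : branchLabel α K c 0 = 0 := rfl
    have := alpha_lt_branchLabel hK (h 0 le_rfl)
    linarith
  | succ j ih =>
    have ih := ih fun i hi => h i (by omega)
    have h1 := h (j + 1) le_rfl
    have := div_lt_div_of_pos_left hK (c := c - branchLabel α K c (j + 1))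
      (b := c - branchLabel α K c j) (by linarith) (by linarith)
    exact add_lt_add_right this α

/-- Two consecutive instances of (g_{j+1} − α)(c − g_j) = K are subtracted. Successive increments
thus have the ratio (g − α) / (c − g) at g = g_{j+1}. -/
theorem branchLabel_diff {j : ℕ} (h : ∀ i ≤ j + 1, branchLabel α K c i < c) :
    (branchLabel α K c (j + 2) - branchLabel α K c (j + 1)) * (c - branchLabel α K c (j + 1)) =
      (branchLabel α K c (j + 1) - α) * (branchLabel α K c (j + 1) - branchLabel α K c j) := by
  have h1 := branchLabel_succ_mul (h j (by omega))
  have h2 := branchLabel_succ_mul (h (j + 1) le_rfl)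
  linear_combination h2 - h1

/-- Moving the root of a path towards an end does not increase the total label of its root. -/
theorem branchLabel_add_le (hα : 0 ≤ α) (hK : 0 < K) {p q : ℕ} (hpq : p ≤ q) (hqp : q ≤ p + 1)
    (h : ∀ i < q, branchLabel α K c i < c)
    (hsum : branchLabel α K c p + branchLabel α K c q ≤ c + α) {t : ℕ} (ht : t ≤ p) :
    (∀ i < q + t, branchLabel α K c i < c) ∧
    branchLabel α K c (p - t) + branchLabel α K c (q + t) ≤
      branchLabel α K c p + branchLabel α K c q ∧
    (0 < t → branchLabel α K c p + branchLabel α K c q < c + α →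
      branchLabel α K c (p - t) + branchLabel α K c (q + t) <
        branchLabel α K c p + branchLabel α K c q) := by
  -- The induction also carries that the last increment gained by the long side is at most the one
  -- lost by the short side.
  have hmain : ∀ t ≤ p, (∀ i < q + t, branchLabel α K c i < c) ∧
      branchLabel α K c (p - t) + branchLabel α K c (q + t) ≤
        branchLabel α K c p + branchLabel α K c q ∧
      (0 < t → branchLabel α K c (q + t) - branchLabel α K c (q + t - 1) ≤
        branchLabel α K c (p - t + 1) - branchLabel α K c (p - t)) ∧
      (0 < t → branchLabel α K c p + branchLabel α K c q < c + α →
        branchLabel α K c (p - t) + branchLabel α K c (q + t) <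
          branchLabel α K c p + branchLabel α K c q) := by
    intro t
    induction t with
    | zero => exact fun _ => ⟨h, le_rfl, by simp, by simp⟩
    | succ t ih =>
      intro ht
      obtain ⟨ih1, ih2, ih3, -⟩ := ih (by omega)
      obtain ⟨L, hL⟩ : ∃ L, p - t = L + 1 := ⟨p - t - 1, by omega⟩
      obtain ⟨R, hR⟩ : ∃ R, q + t = R + 1 := ⟨q + t - 1, by omega⟩
      have hL' : p - (t + 1) = L := by omega
      have hR' : q + (t + 1) = R + 2 := by omega
      rw [hL, hR] at ih2 ih3
      rw [hR] at ih1
      rw [hL', hR']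
      have hgL : α < branchLabel α K c (L + 1) := alpha_lt_branchLabel hK (ih1 L (by omega))
      have hgR : α < branchLabel α K c (R + 1) := alpha_lt_branchLabel hK (ih1 R (by omega))
      -- The two labels add up to at most c + α and the other one exceeds α, so the recursion can
      -- continue.
      have hRc : branchLabel α K c (R + 1) < c := by linarith
      have hnew : ∀ i < R + 2, branchLabel α K c i < c := by
        intro i hi
        rcases (show i < R + 1 ∨ i = R + 1 by omega) with hi | rfl
        · exact ih1 i hi
        · exact hRc
      have hLpos := branchLabel_lt_succ hα hK (j := L) fun i hi => hnew i (by omega)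
      have hRpos := branchLabel_lt_succ hα hK (j := R) fun i hi => hnew i (by omega)
      have hdR := branchLabel_diff (j := R) fun i hi => hnew i (by omega)
      have hdL := branchLabel_diff (j := L) fun i hi => hnew i (by omega)
      have hLc := hnew (L + 1) (by omega)
      set gL := branchLabel α K c L
      set gL1 := branchLabel α K c (L + 1) with hgL1
      set gL2 := branchLabel α K c (L + 2) with hgL2
      set gR := branchLabel α K c R with hgR0
      set gR1 := branchLabel α K c (R + 1) with hgR1
      set gR2 := branchLabel α K c (R + 2) with hgR2
      have hs1 : gR1 - α ≤ c - gL1 := by linarith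
      have hs2 : gL1 - α ≤ c - gR1 := by linarith
      have key : gR2 - gR1 ≤ gL1 - gL ∧
          (branchLabel α K c p + branchLabel α K c q < c + α → gR2 - gR1 < gL1 - gL) := by
        -- Equal sides occur only at the start, where one ratio (at most 1) suffices. Otherwise the
        -- previous increments are compared and the ratios at both ends are combined.
        by_cases hbase : q + t = p - t
        · have hLR : L = R := by omega
          subst hLR
          have hcR : 0 < c - gR1 := by linarith
          have hcast : (gR2 - gR1) * (c - gR1) = (gR1 - α) * (gL1 - gL) := hdR
          refine ⟨le_of_mul_le_mul_right ?_ hcR, fun hlt => lt_of_mul_lt_mul_right ?_ hcR.le⟩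
          · rw [hcast, mul_comm]
            exact mul_le_mul_of_nonneg_left hs2 (by linarith)
          · rw [hcast, mul_comm]
            exact mul_lt_mul_of_pos_left (by linarith) (by linarith)
        · have hle : gR1 - gR ≤ gL2 - gL1 := by
            rcases Nat.eq_zero_or_pos t with rfl | ht0
            · have : R = L + 1 := by omega
              subst this
              exact le_rfl
            · simpa using ih3 ht0
          have hcR : 0 < c - gR1 := by linarith
          have hcL : 0 < c - gL1 := by linarith
          have hD : 0 < gL1 - gL := by linarith
          have h1 : (gR2 - gR1) * ((c - gR1) * (c - gL1)) ≤
              (gL1 - gL) * ((gL1 - α) * (gR1 - α)) := by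
            have e1 : (gR2 - gR1) * ((c - gR1) * (c - gL1)) =
              (gR1 - gR) * ((gR1 - α) * (c - gL1)) := by linear_combination (c - gL1) * hdR
            have e2 : (gL1 - gL) * ((gL1 - α) * (gR1 - α)) =
              (gL2 - gL1) * ((gR1 - α) * (c - gL1)) := by linear_combination -(gR1 - α) * hdL
            rw [e1, e2]
            exact mul_le_mul_of_nonneg_right hle
              (mul_nonneg (by linarith) hcL.le)
          refine ⟨le_of_mul_le_mul_right (h1.trans ?_) (mul_pos hcR hcL),
            fun hlt => lt_of_mul_lt_mul_right (h1.trans_lt ?_) (mul_pos hcR hcL).le⟩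
          · refine mul_le_mul_of_nonneg_left ?_ hD.le
            exact mul_le_mul hs2 hs1 (by linarith) hcR.le
          · refine mul_lt_mul_of_pos_left ?_ hD
            exact mul_lt_mul'' (by linarith) (by linarith) (by linarith) (by linarith)
      refine ⟨hnew, by linarith [key.1], fun _ => by simpa using key.1, fun _ hlt => ?_⟩
      linarith [key.2 hlt]
  obtain ⟨h1, h2, -, h4⟩ := hmain t ht
  exact ⟨h1, h2, h4⟩

end Balance

/-! ### The form of the tensor and its eigenvalues -/

/-- The form `∑ T x_{i₁} ⋯ x_{i_k}` of the tensor `α D + (1 - α) A` of a hypergraph with the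
edges `E`. -/
noncomputable def edgeForm {W : Type*} (α : ℝ) (k : ℕ) (E : Finset (Finset W)) (x : W → ℝ) : ℝ :=
  ∑ e ∈ E, (α * ∑ v ∈ e, x v ^ k + (1 - α) * k * ∏ v ∈ e, x v)

/-- The `i`-th entry of `T x`, for the tensor `T = α D + (1 - α) A` of a hypergraph with the
edges `E`. -/
noncomputable def edgeGrad {W R : Type*} [CommRing R] [DecidableEq W] (α : R) (k : ℕ)
    (E : Finset (Finset W)) (x : W → R) (i : W) : R :=
  α * (E.filter (i ∈ ·)).card * x i ^ (k - 1) +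
    (1 - α) * ∑ e ∈ E.filter (i ∈ ·), ∏ v ∈ e.erase i, x v

section EdgeForm

variable {W : Type*} [Fintype W] [DecidableEq W] {α : ℝ} {k : ℕ} {E : Finset (Finset W)}

theorem sum_mul_edgeGrad (hk : 1 ≤ k) (hE : ∀ e ∈ E, e.card = k) (x : W → ℝ) :
    ∑ i, x i * edgeGrad α k E x i = edgeForm α k E x := by
  have hterm : ∀ i, x i * edgeGrad α k E x i =
      ∑ e ∈ E, if i ∈ e then α * x i ^ k + (1 - α) * ∏ v ∈ e, x v else 0 := by
    intro i
    rw [← Finset.sum_filter, Finset.sum_add_distrib, Finset.sum_const, nsmul_eq_mul,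
      ← Finset.mul_sum, edgeGrad, mul_add, ← mul_assoc (x i) (1 - α), mul_comm (x i) (1 - α),
      mul_assoc (1 - α), Finset.mul_sum]
    congr 1
    · obtain ⟨r, rfl⟩ : ∃ r, k = r + 1 := ⟨k - 1, by omega⟩
      rw [Nat.add_sub_cancel, pow_succ]
      ring
    · congr 1
      refine Finset.sum_congr rfl fun e he => ?_
      exact Finset.mul_prod_erase _ _ (Finset.mem_filter.1 he).2
  rw [Finset.sum_congr rfl fun i _ => hterm i, Finset.sum_comm, edgeForm]
  refine Finset.sum_congr rfl fun e he => ?_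
  rw [← Finset.sum_filter, Finset.filter_mem_eq_inter, Finset.univ_inter, Finset.sum_add_distrib,
    Finset.sum_const, hE e he, ← Finset.mul_sum, nsmul_eq_mul]
  ring

omit [Fintype W] [DecidableEq W] in
theorem continuous_edgeForm : Continuous (edgeForm α k E) := by
  unfold edgeForm
  fun_prop

/-- As `x` is positive, it is a local minimum of ρ ∑ y_v^k minus the form in each coordinate. The
derivative in the `i`-th one is `k` times the difference of the two sides. -/
theorem edgeGrad_eq_of_isMax (hk : 1 ≤ k) {ρ : ℝ}
    (hle : ∀ y : W → ℝ, (∀ v, 0 ≤ y v) → edgeForm α k E y ≤ ρ * ∑ v, y v ^ k)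
    {x : W → ℝ} (hx : ∀ v, 0 < x v) (heq : edgeForm α k E x = ρ * ∑ v, x v ^ k) (i : W) :
    edgeGrad α k E x i = ρ * x i ^ (k - 1) := by
  set u : ℝ → W → ℝ := fun t => Function.update x i t with hu
  have hui : ∀ t, u t i = t := fun t => Function.update_self _ _ _
  have hun : ∀ t v, v ≠ i → u t v = x v := fun t v hv => Function.update_of_ne hv _ _
  have hux : u (x i) = x := Function.update_eq_self _ _
  have hsumpow : ∀ (s : Finset W) (t : ℝ),
      HasDerivAt (fun t => ∑ v ∈ s, u t v ^ k) (if i ∈ s then (k : ℝ) * t ^ (k - 1) else 0) t := by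
    intro s t
    by_cases his : i ∈ s
    · rw [if_pos his]
      have : (fun t => ∑ v ∈ s, u t v ^ k) = fun t => t ^ k + ∑ v ∈ s.erase i, x v ^ k := by
        funext t
        rw [← Finset.add_sum_erase _ _ his, hui]
        congr 1
        exact Finset.sum_congr rfl fun v hv => by rw [hun t v (Finset.ne_of_mem_erase hv)]
      rw [this]
      exact (hasDerivAt_pow k t).add_const _
    · rw [if_neg his]
      have : (fun t => ∑ v ∈ s, u t v ^ k) = fun t => ∑ v ∈ s, x v ^ k := by
        funext t
        exact Finset.sum_congr rfl fun v hv => by rw [hun t v (fun h => his (h ▸ hv))]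
      rw [this]
      exact hasDerivAt_const _ _
  have hprod : ∀ (s : Finset W) (t : ℝ),
      HasDerivAt (fun t => ∏ v ∈ s, u t v) (if i ∈ s then ∏ v ∈ s.erase i, x v else 0) t := by
    intro s t
    by_cases his : i ∈ s
    · rw [if_pos his]
      have : (fun t => ∏ v ∈ s, u t v) = fun t => t * ∏ v ∈ s.erase i, x v := by
        funext t
        rw [← Finset.mul_prod_erase _ _ his, hui]
        congr 1
        exact Finset.prod_congr rfl fun v hv => by rw [hun t v (Finset.ne_of_mem_erase hv)]
      rw [this]
      simpa using (hasDerivAt_id t).mul_const (∏ v ∈ s.erase i, x v)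
    · rw [if_neg his]
      have : (fun t => ∏ v ∈ s, u t v) = fun t => ∏ v ∈ s, x v := by
        funext t
        exact Finset.prod_congr rfl fun v hv => by rw [hun t v (fun h => his (h ▸ hv))]
      rw [this]
      exact hasDerivAt_const _ _
  have hform : HasDerivAt (fun t => edgeForm α k E (u t)) (k * edgeGrad α k E x i) (x i) := by
    have hd := HasDerivAt.fun_sum (u := E) (x := x i) fun e _ =>
      (((hsumpow e (x i)).const_mul α).add ((hprod e (x i)).const_mul ((1 - α) * k)))
    simp only [mul_ite, mul_zero] at hd
    rw [Finset.sum_add_distrib, ← Finset.sum_filter, ← Finset.sum_filter, Finset.sum_const,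
      nsmul_eq_mul, ← Finset.mul_sum] at hd
    refine hd.congr_deriv ?_
    simp only [edgeGrad]
    ring
  have hd := ((hsumpow Finset.univ (x i)).const_mul ρ).sub hform
  have hmin : IsLocalMin (fun t => ρ * ∑ v, u t v ^ k - edgeForm α k E (u t)) (x i) := by
    filter_upwards [lt_mem_nhds (hx i)] with t ht
    rw [hux, heq, sub_self, sub_nonneg]
    refine hle _ fun v => ?_
    by_cases hv : v = i
    · rw [hv, hui]; exact ht.le
    · rw [hun t v hv]; exact (hx v).le
  have h0 := hmin.hasDerivAt_eq_zero hd
  rw [if_pos (Finset.mem_univ i)] at h0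
  have hk0 : (k : ℝ) ≠ 0 := by positivity
  apply mul_left_cancel₀ hk0
  linarith

/-- The triangle inequality in each eigenvalue equation, multiplied by |y_i| and summed. -/
theorem norm_mul_le_edgeForm (hk : 1 ≤ k) (hα0 : 0 ≤ α) (hα1 : α ≤ 1)
    (hE : ∀ e ∈ E, e.card = k) {μ : ℂ} {y : W → ℂ}
    (hy : ∀ i, edgeGrad (α : ℂ) k E y i = μ * y i ^ (k - 1)) :
    ‖μ‖ * ∑ i, ‖y i‖ ^ k ≤ edgeForm α k E fun i => ‖y i‖ := by
  rw [← sum_mul_edgeGrad hk hE, Finset.mul_sum]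
  refine Finset.sum_le_sum fun i _ => ?_
  have h1 : ‖μ‖ * ‖y i‖ ^ (k - 1) ≤ edgeGrad α k E (fun i => ‖y i‖) i := by
    rw [← norm_pow, ← norm_mul, ← hy i, edgeGrad, edgeGrad]
    refine (norm_add_le _ _).trans (add_le_add (le_of_eq ?_) ?_)
    · rw [norm_mul, norm_mul, norm_pow, Complex.norm_real, Complex.norm_natCast,
        Real.norm_of_nonneg hα0]
    · rw [norm_mul, ← Complex.ofReal_one, ← Complex.ofReal_sub, Complex.norm_real,
        Real.norm_of_nonneg (by linarith)]
      refine mul_le_mul_of_nonneg_left ((norm_sum_le _ _).trans (le_of_eq ?_)) (by linarith)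
      exact Finset.sum_congr rfl fun e _ => norm_prod _ _
  calc ‖μ‖ * ‖y i‖ ^ k = ‖y i‖ * (‖μ‖ * ‖y i‖ ^ (k - 1)) := by
        obtain ⟨r, rfl⟩ : ∃ r, k = r + 1 := ⟨k - 1, by omega⟩
        rw [Nat.add_sub_cancel, pow_succ]
        ring
    _ ≤ _ := mul_le_mul_of_nonneg_left h1 (norm_nonneg _)

omit [DecidableEq W] in
-- The normalised nonnegative vectors form a compact set. The resulting gap keeps the inequality
-- strict after passing to the supremum over eigenvalues.
theorem exists_edgeForm_bound (hk : 1 ≤ k) {ρ : ℝ}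
    (h : ∀ x : W → ℝ, (∀ v, 0 ≤ x v) → x ≠ 0 → edgeForm α k E x < ρ * ∑ v, x v ^ k) :
    ∃ M < ρ, ∀ x : W → ℝ, (∀ v, 0 ≤ x v) → ∑ v, x v ^ k = 1 → edgeForm α k E x ≤ M := by
  set S : Set (W → ℝ) := {x | (∀ v, 0 ≤ x v) ∧ ∑ v, x v ^ k = 1} with hS
  have hcl : IsClosed S := by
    have hS' : S = Set.Ici 0 ∩ {x | ∑ v, x v ^ k = 1} := rfl
    rw [hS']
    exact isClosed_Ici.inter (isClosed_eq (by fun_prop) continuous_const)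
  have hcomp : IsCompact S := by
    refine (isCompact_Icc (a := (0 : W → ℝ)) (b := 1)).of_isClosed_subset hcl ?_
    rintro x ⟨hx0, hx1⟩
    refine ⟨hx0, fun v => ?_⟩
    have : x v ^ k ≤ 1 := hx1 ▸ Finset.single_le_sum (f := fun v => x v ^ k)
      (fun w _ => pow_nonneg (hx0 w) k) (Finset.mem_univ v)
    exact (pow_le_one_iff_of_nonneg (hx0 v) (by omega)).1 this
  rcases S.eq_empty_or_nonempty with hemp | hne
  · refine ⟨ρ - 1, by linarith, fun x hx0 hx1 => ?_⟩
    exact absurd (show x ∈ S from ⟨hx0, hx1⟩) (by simp [hemp])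
  · obtain ⟨x, hx, hmax⟩ := hcomp.exists_isMaxOn hne continuous_edgeForm.continuousOn
    refine ⟨edgeForm α k E x, ?_, fun y hy0 hy1 => hmax ⟨hy0, hy1⟩⟩
    have := h x hx.1 (by rintro rfl; simpa [zero_pow (by omega : k ≠ 0)] using hx.2)
    rwa [hx.2, mul_one] at this

omit [Fintype W] [DecidableEq W] in
theorem edgeForm_smul (hE : ∀ e ∈ E, e.card = k) (c : ℝ) (x : W → ℝ) :
    edgeForm α k E (fun v => c * x v) = c ^ k * edgeForm α k E x := by
  rw [edgeForm, edgeForm, Finset.mul_sum]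
  refine Finset.sum_congr rfl fun e he => ?_
  simp only [mul_pow, ← Finset.mul_sum, Finset.prod_mul_distrib, Finset.prod_const, hE e he]
  ring

theorem norm_le_of_edgeForm_le (hk : 1 ≤ k) (hα0 : 0 ≤ α) (hα1 : α ≤ 1)
    (hE : ∀ e ∈ E, e.card = k) {M : ℝ}
    (hM : ∀ x : W → ℝ, (∀ v, 0 ≤ x v) → ∑ v, x v ^ k = 1 → edgeForm α k E x ≤ M)
    {μ : ℂ} {y : W → ℂ} (hy0 : y ≠ 0)
    (hy : ∀ i, edgeGrad (α : ℂ) k E y i = μ * y i ^ (k - 1)) : ‖μ‖ ≤ M := by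
  have hle := norm_mul_le_edgeForm hk hα0 hα1 hE hy
  obtain ⟨i, hi⟩ := Function.ne_iff.1 hy0
  have hpos : 0 < ∑ i, ‖y i‖ ^ k :=
    Finset.sum_pos' (fun v _ => by positivity) ⟨i, Finset.mem_univ i, by
      have : 0 < ‖y i‖ := norm_pos_iff.2 hi
      positivity⟩
  set N := ∑ i, ‖y i‖ ^ k with hN
  set c : ℝ := (N⁻¹) ^ ((k : ℝ)⁻¹) with hc
  have hck : c ^ k = N⁻¹ := Real.rpow_inv_natCast_pow (by positivity) (by omega)
  have h1 := hM (fun v => c * ‖y v‖) (fun v => by positivity) (by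
    simp only [mul_pow, ← Finset.mul_sum, hck]
    rw [← hN, inv_mul_cancel₀ hpos.ne'])
  rw [edgeForm_smul hE, hck] at h1
  have h2 := mul_le_mul_of_nonneg_left hle (inv_nonneg.2 hpos.le)
  rw [mul_comm ‖μ‖, inv_mul_cancel_left₀ hpos.ne'] at h2
  exact h2.trans h1

end EdgeForm

/-- These tuples are the orderings of `e.erase i`; their number cancels the factor 1/(k−1)! of the
adjacency tensor. -/
theorem card_filter_insert_image_eq {W : Type*} [Fintype W] [DecidableEq W] {r : ℕ} {i : W}
    {e : Finset W} (hi : i ∈ e) (he : e.card = r + 1) :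
    (Finset.univ.filter fun f : Fin r → W => insert i (Finset.univ.image f) = e).card =
      r.factorial ∧
    ∀ f : Fin r → W, insert i (Finset.univ.image f) = e → ∀ x : W → ℂ,
      ∏ j, x (f j) = ∏ v ∈ e.erase i, x v := by
  have hcard : (e.erase i).card = r := by rw [Finset.card_erase_of_mem hi, he]; omega
  have himg : ∀ f : Fin r → W, insert i (Finset.univ.image f) = e →
      Finset.univ.image f = e.erase i ∧ Function.Injective f := by
    intro f hf
    have hsub : e.erase i ⊆ Finset.univ.image f := by
      rw [← hf]
      exact Finset.erase_insert_subset _ _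
    have hle : (Finset.univ.image f).card ≤ r := by
      simpa using Finset.card_image_le (s := Finset.univ) (f := f)
    have heq := (Finset.eq_of_subset_of_card_le hsub (by omega)).symm
    refine ⟨heq, fun a b hab => ?_⟩
    have : Set.InjOn f (Finset.univ : Finset (Fin r)) :=
      Finset.card_image_iff.1 (by rw [heq, hcard]; simp)
    exact this (by simp) (by simp) hab
  constructor
  · have hemb : Fintype.card (Fin r ↪ (e.erase i : Finset W)) = r.factorial := by
      rw [Fintype.card_embedding_eq, Fintype.card_coe, hcard, Fintype.card_fin,
        Nat.descFactorial_self]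
    rw [← hemb, ← Finset.card_univ]
    symm
    refine Finset.card_bij (fun g _ j => (g j : W)) ?_ ?_ ?_
    · intro g _
      rw [Finset.mem_filter]
      refine ⟨Finset.mem_univ _, ?_⟩
      have hsub : Finset.univ.image (fun j => (g j : W)) ⊆ e.erase i := by
        intro w hw
        obtain ⟨j, -, rfl⟩ := Finset.mem_image.1 hw
        exact (g j).2
      rw [Finset.eq_of_subset_of_card_le hsub (by
        rw [hcard, ← Function.comp_def,
          Finset.card_image_of_injective _ (Subtype.val_injective.comp g.injective)]
        simp), Finset.insert_erase hi]
    · intro g _ g' _ h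
      ext j
      exact congrFun h j
    · intro f hf
      obtain ⟨h1, h2⟩ := himg f (Finset.mem_filter.1 hf).2
      refine ⟨⟨fun j => ⟨f j, h1 ▸ Finset.mem_image_of_mem _ (Finset.mem_univ j)⟩,
        fun a b hab => h2 (by simpa using hab)⟩, Finset.mem_univ _, rfl⟩
  · intro f hf x
    obtain ⟨h1, h2⟩ := himg f hf
    rw [← h1, Finset.prod_image fun a _ b _ hab => h2 hab]

/-! ### The `α`-spectral radius in terms of the form -/

namespace Hypergraph

variable {V : Type*} (G : Hypergraph V) [Fintype G.vertexSet]

open Classical in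
/-- The edges, as finsets of vertices. -/
noncomputable def edgeFinset : Finset (Finset G.vertexSet) :=
  Finset.univ.filter fun e => Subtype.val '' (e : Set G.vertexSet) ∈ G.edgeSet

variable {G}

theorem mem_edgeFinset {e : Finset G.vertexSet} :
    e ∈ G.edgeFinset ↔ Subtype.val '' (e : Set G.vertexSet) ∈ G.edgeSet := by
  simp [edgeFinset]

theorem exists_mem_edgeFinset {e : Set V} (he : e ∈ G.edgeSet) :
    ∃ e' ∈ G.edgeFinset, Subtype.val '' (e' : Set G.vertexSet) = e := by
  classical
  have : Subtype.val '' ((Finset.univ.filter fun w : G.vertexSet => (w : V) ∈ e :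
      Finset G.vertexSet) : Set G.vertexSet) = e := by
    ext w
    simp only [Finset.coe_filter, Finset.mem_univ, true_and, Set.mem_image, Set.mem_ofPred_eq,
      Subtype.exists, exists_and_right, exists_eq_right]
    exact ⟨fun ⟨_, h⟩ => h, fun h => ⟨G.subset_vertexSet_of_mem_edgeSet' he h, h⟩⟩
  exact ⟨_, mem_edgeFinset.2 (this.symm ▸ he), this⟩

omit [Fintype G.vertexSet] in
theorem image_val_injective :
    Function.Injective fun e : Finset G.vertexSet => Subtype.val '' (e : Set G.vertexSet) :=
  (Set.image_injective.2 Subtype.val_injective).comp Finset.coe_injective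

theorem IsUniform.card_eq {k : ℕ} (hG : G.IsUniform k) {e : Finset G.vertexSet}
    (he : e ∈ G.edgeFinset) : e.card = k := by
  rw [← (hG _ (mem_edgeFinset.1 he)).2, Set.ncard_image_of_injective _ Subtype.val_injective,
    Set.ncard_coe_finset]

theorem card_edgeFinset : G.edgeFinset.card = G.edgeSet.ncard := by
  rw [← Set.ncard_coe_finset, ← Set.ncard_image_of_injective _ G.image_val_injective]
  congr 1
  ext e
  constructor
  · rintro ⟨e', he', rfl⟩
    exact mem_edgeFinset.1 he'
  · intro he
    obtain ⟨e', he', rfl⟩ := exists_mem_edgeFinset he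
    exact ⟨e', he', rfl⟩

theorem card_filter_edgeFinset [DecidableEq G.vertexSet] (i : G.vertexSet) :
    (G.edgeFinset.filter (i ∈ ·)).card = G.degree i := by
  rw [degree, ← Set.ncard_coe_finset, ← Set.ncard_image_of_injective _ G.image_val_injective]
  congr 1
  ext e
  constructor
  · rintro ⟨e', he', rfl⟩
    obtain ⟨h1, h2⟩ := Finset.mem_filter.1 he'
    exact ⟨mem_edgeFinset.1 h1, i, h2, rfl⟩
  · rintro ⟨he, hi⟩
    obtain ⟨e', he', rfl⟩ := exists_mem_edgeFinset he
    exact ⟨e', Finset.mem_coe.2 (Finset.mem_filter.2 ⟨he', by simpa using hi⟩), rfl⟩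

theorem apply_alphaTensor [DecidableEq G.vertexSet] {k : ℕ} (hk : 1 ≤ k) (hG : G.IsUniform k)
    (α : ℝ) (x : G.vertexSet → ℂ) (i : G.vertexSet) :
    (G.alphaTensor k α).apply x i = edgeGrad (α : ℂ) k G.edgeFinset x i := by
  have hdeg : ∑ f : Fin (k - 1) → G.vertexSet, G.degTensor k (Fin.cons i f) * ∏ j, x (f j) =
      (G.edgeFinset.filter (i ∈ ·)).card * x i ^ (k - 1) := by
    rw [Finset.sum_eq_single (fun _ => i)]
    · rw [degTensor, if_pos, card_filter_edgeFinset]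
      · simp
      · intro j
        induction j using Fin.cases <;> simp
    · intro f _ hf
      rw [degTensor, if_neg, zero_mul]
      intro h
      exact hf (funext fun j => by simpa using h j.succ)
    · simp
  have hrange : ∀ f : Fin (k - 1) → G.vertexSet,
      (Set.range fun j => ((Fin.cons i f : Fin (k - 1 + 1) → G.vertexSet) j : V)) =
        Subtype.val '' ((insert i (Finset.univ.image f) : Finset G.vertexSet) :
          Set G.vertexSet) := by
    intro f
    rw [← Function.comp_def, Set.range_comp, Fin.range_cons]
    simp
  have hadj : ∑ f : Fin (k - 1) → G.vertexSet, G.adjTensor k (Fin.cons i f) * ∏ j, x (f j) =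
      ∑ e ∈ G.edgeFinset.filter (i ∈ ·), ∏ v ∈ e.erase i, x v := by
    have h1 : ∀ f : Fin (k - 1) → G.vertexSet, G.adjTensor k (Fin.cons i f) * ∏ j, x (f j) =
        ∑ e ∈ G.edgeFinset.filter (i ∈ ·), if insert i (Finset.univ.image f) = e then
          1 / ((k - 1).factorial : ℂ) * ∏ v ∈ e.erase i, x v else 0 := by
      intro f
      rw [adjTensor, hrange, Finset.sum_ite_eq, ← mem_edgeFinset]
      by_cases hf : insert i (Finset.univ.image f) ∈ G.edgeFinset
      · have hm : insert i (Finset.univ.image f) ∈ G.edgeFinset.filter (i ∈ ·) :=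
          Finset.mem_filter.2 ⟨hf, Finset.mem_insert_self _ _⟩
        rw [if_pos hf, if_pos hm, (card_filter_insert_image_eq (Finset.mem_insert_self i (Finset.univ.image f))
            (by rw [hG.card_eq hf]; omega)).2 f rfl]
      · rw [if_neg hf, if_neg fun h => hf (Finset.mem_filter.1 h).1, zero_mul]
    rw [Finset.sum_congr rfl fun f _ => h1 f, Finset.sum_comm]
    refine Finset.sum_congr rfl fun e he => ?_
    obtain ⟨he, hie⟩ := Finset.mem_filter.1 he
    rw [← Finset.sum_filter, Finset.sum_const,
      (card_filter_insert_image_eq hie (by rw [hG.card_eq he]; omega)).1, nsmul_eq_mul, ← mul_assoc,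
      mul_one_div_cancel (Nat.cast_ne_zero.2 (Nat.factorial_ne_zero _)), one_mul]
  simp only [HTensor.apply, alphaTensor, add_mul, Finset.sum_add_distrib, mul_assoc,
    ← Finset.mul_sum, hdeg, hadj, edgeGrad]

theorem isEigenvalue_alphaTensor [DecidableEq G.vertexSet] {k : ℕ} (hk : 1 ≤ k)
    (hG : G.IsUniform k) (α : ℝ) {μ : ℂ} : (G.alphaTensor k α).IsEigenvalue μ ↔
      ∃ x : G.vertexSet → ℂ, x ≠ 0 ∧
        ∀ i, edgeGrad (α : ℂ) k G.edgeFinset x i = μ * x i ^ (k - 1) := by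
  simp only [HTensor.IsEigenvalue, apply_alphaTensor hk hG]

theorem alphaSpectralRadius_le {k : ℕ} (hk : 1 ≤ k) (hG : G.IsUniform k) {α : ℝ} (hα0 : 0 ≤ α)
    (hα1 : α ≤ 1) {M : ℝ} (hM0 : 0 ≤ M) (hM : ∀ x : G.vertexSet → ℝ, (∀ v, 0 ≤ x v) →
      ∑ v, x v ^ k = 1 → edgeForm α k G.edgeFinset x ≤ M) : G.alphaSpectralRadius k α ≤ M := by
  classical
  refine Real.sSup_le ?_ hM0
  rintro t ⟨μ, hμ, rfl⟩
  obtain ⟨y, hy0, hy⟩ := (isEigenvalue_alphaTensor hk hG α).1 hμ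
  exact norm_le_of_edgeForm_le hk hα0 hα1 (fun e he => hG.card_eq he) hM hy0 hy

theorem alphaSpectralRadius_lt {k : ℕ} (hk : 1 ≤ k) (hG : G.IsUniform k) {α : ℝ} (hα0 : 0 ≤ α)
    (hα1 : α ≤ 1) {ρ : ℝ} (hρ : 0 < ρ) (h : ∀ x : G.vertexSet → ℝ, (∀ v, 0 ≤ x v) → x ≠ 0 →
      edgeForm α k G.edgeFinset x < ρ * ∑ v, x v ^ k) : G.alphaSpectralRadius k α < ρ := by
  classical
  obtain ⟨M, hM, hle⟩ := exists_edgeForm_bound hk h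
  -- `M` could be negative, whereas the supremum of an empty set of moduli is 0.
  exact (alphaSpectralRadius_le hk hG hα0 hα1 (le_max_left 0 M)
    fun x h0 h1 => (hle x h0 h1).trans (le_max_right _ _)).trans_lt (max_lt hρ hM)

/-- The equality makes ρ an eigenvalue; the inequality also bounds the set of moduli, without which
the supremum would say nothing. -/
theorem le_alphaSpectralRadius [Nonempty G.vertexSet] {k : ℕ} (hk : 1 ≤ k) (hG : G.IsUniform k)
    {α : ℝ} (hα0 : 0 ≤ α) (hα1 : α ≤ 1) {ρ : ℝ} (hle : ∀ y : G.vertexSet → ℝ, (∀ v, 0 ≤ y v) →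
      edgeForm α k G.edgeFinset y ≤ ρ * ∑ v, y v ^ k)
    {x : G.vertexSet → ℝ} (hx : ∀ v, 0 < x v)
    (heq : edgeForm α k G.edgeFinset x = ρ * ∑ v, x v ^ k) :
    ρ ≤ G.alphaSpectralRadius k α := by
  classical
  have hgrad := edgeGrad_eq_of_isMax hk hle hx heq
  refine (le_abs_self ρ).trans (le_csSup ⟨ρ, ?_⟩ ⟨(ρ : ℂ), ?_, Complex.norm_real ρ⟩)
  · rintro t ⟨μ, hμ, rfl⟩
    obtain ⟨y, hy0, hy⟩ := (isEigenvalue_alphaTensor hk hG α).1 hμ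
    refine norm_le_of_edgeForm_le hk hα0 hα1 (fun e he => hG.card_eq he) (fun z h0 h1 => ?_) hy0 hy
    simpa [h1] using hle z h0
  · refine (isEigenvalue_alphaTensor hk hG α).2 ⟨fun i => (x i : ℂ), ?_, fun i => ?_⟩
    · intro h0
      obtain ⟨i⟩ := ‹Nonempty G.vertexSet›
      exact (hx i).ne' (by simpa using congrFun h0 i)
    · have := hgrad i
      have hc := congrArg (fun t : ℝ => (t : ℂ)) this
      simp only [edgeGrad] at hc ⊢
      push_cast at hc
      exact hc

end Hypergraph

/-! ### AM–GM for a single edge -/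

section AmGm

variable {W : Type*} [DecidableEq W] {k : ℕ}

omit [DecidableEq W] in
-- AM–GM with equal weights for the `k` numbers β y^k and B_v x_v^k. Indexing by `Option W` keeps
-- `y` independent of `x`, so that it may be the value at a vertex outside the edge.
theorem amgm_edge {s : Finset W} (hs : s.card + 1 = k) {x B : W → ℝ} {y β γ : ℝ} (hy : 0 ≤ y)
    (hβ : 0 ≤ β) (hγ : 0 ≤ γ) (hx : ∀ v ∈ s, 0 ≤ x v) (hB : ∀ v ∈ s, 0 ≤ B v)
    (hprod : β * ∏ v ∈ s, B v = γ ^ k) :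
    γ * k * (y * ∏ v ∈ s, x v) ≤ β * y ^ k + ∑ v ∈ s, B v * x v ^ k ∧
    (γ * k * (y * ∏ v ∈ s, x v) = β * y ^ k + ∑ v ∈ s, B v * x v ^ k ↔
      ∀ v ∈ s, B v * x v ^ k = β * y ^ k) := by
  have hk0 : k ≠ 0 := by omega
  have hk : (0 : ℝ) < k := by positivity
  set z : Option W → ℝ := fun o => o.elim (β * y ^ k) fun v => B v * x v ^ k with hz
  set w : Option W → ℝ := fun _ => (k : ℝ)⁻¹ with hw
  have hz0 : ∀ o ∈ s.insertNone, 0 ≤ z o := by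
    intro o ho
    rcases o with _ | v
    · exact mul_nonneg hβ (pow_nonneg hy _)
    · have hv : v ∈ s := by simpa using ho
      exact mul_nonneg (hB v hv) (pow_nonneg (hx v hv) _)
  have hw0 : ∀ o ∈ s.insertNone, 0 < w o := fun _ _ => inv_pos.2 hk
  have hw1 : ∑ o ∈ s.insertNone, w o = 1 := by
    rw [Finset.sum_const, Finset.card_insertNone, hs, nsmul_eq_mul, mul_inv_cancel₀ hk.ne']
  have hP : 0 ≤ ∏ v ∈ s, x v := Finset.prod_nonneg hx
  have hgeom : ∏ o ∈ s.insertNone, z o ^ w o = γ * (y * ∏ v ∈ s, x v) := by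
    rw [Real.finsetProd_rpow _ _ hz0, Finset.prod_insertNone]
    simp only [hz, Option.elim]
    rw [Finset.prod_mul_distrib, Finset.prod_pow]
    have : β * y ^ k * ((∏ v ∈ s, B v) * (∏ v ∈ s, x v) ^ k) = (γ * (y * ∏ v ∈ s, x v)) ^ k := by
      rw [mul_pow, mul_pow, ← hprod]
      ring
    rw [this]
    exact Real.pow_rpow_inv_natCast (mul_nonneg hγ (mul_nonneg hy hP)) hk0
  have harith : ∑ o ∈ s.insertNone, w o * z o =
      (k : ℝ)⁻¹ * (β * y ^ k + ∑ v ∈ s, B v * x v ^ k) := by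
    rw [← Finset.mul_sum, Finset.sum_insertNone]
    rfl
  have hle := Real.geom_mean_le_arith_mean_weighted _ w z (fun o ho => (hw0 o ho).le) hw1 hz0
  have hiff := Real.geom_mean_eq_arith_mean_weighted_iff_of_pos _ w z hw0 hw1 hz0
  rw [hgeom, harith] at hle hiff
  have hcomm : γ * k * (y * ∏ v ∈ s, x v) = k * (γ * (y * ∏ v ∈ s, x v)) := by ring
  rw [hcomm]
  constructor
  · rwa [le_inv_mul_iff₀ hk] at hle
  · rw [eq_inv_mul_iff_mul_eq₀ hk.ne'] at hiff
    rw [hiff]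
    constructor
    · intro h v hv
      exact h (some v) (by simpa using hv) none (by simp)
    · intro h
      have : ∀ o ∈ s.insertNone, z o = β * y ^ k := by
        intro o ho
        rcases o with _ | v
        · rfl
        · exact h v (by simpa using ho)
      intro o ho o' ho'
      rw [this o ho, this o' ho']

/-- The contribution of an edge to `edgeForm` is bounded by the labels of its vertices. The edge
consists of `s` and a further vertex with value `y₀`, which may be raised to `y`. -/
theorem edge_bound (hk : 2 ≤ k) {α c K h l : ℝ} (hα0 : 0 ≤ α) (hα1 : α < 1) (hc : 0 < c)
    (hK : K * c ^ (k - 2) = (1 - α) ^ k) (hh : α < h) (hl0 : 0 ≤ l) (hlc : l < c)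
    (hlabel : (h - α) * (c - l) = K) {s : Finset W} (hs : s.card + 1 = k) {w₀ : W} (hw₀ : w₀ ∈ s)
    {x : W → ℝ} (hx : ∀ v ∈ s, 0 ≤ x v) {y₀ y : ℝ} (hy₀ : 0 ≤ y₀) (hy : y₀ ≤ y) :
    α * (y₀ ^ k + ∑ v ∈ s, x v ^ k) + (1 - α) * k * (y₀ * ∏ v ∈ s, x v) ≤
      (c + α) * ∑ v ∈ s, x v ^ k + h * y ^ k - l * x w₀ ^ k ∧
    (α * (y₀ ^ k + ∑ v ∈ s, x v ^ k) + (1 - α) * k * (y₀ * ∏ v ∈ s, x v) =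
      (c + α) * ∑ v ∈ s, x v ^ k + h * y ^ k - l * x w₀ ^ k → 0 < y →
      y₀ = y ∧ ∀ v ∈ s, 0 < x v ∧ (h + l < c + α → x v < y)) ∧
    (y₀ = y → (∀ v ∈ s, (c - if v = w₀ then l else 0) * x v ^ k = (h - α) * y ^ k) →
      α * (y₀ ^ k + ∑ v ∈ s, x v ^ k) + (1 - α) * k * (y₀ * ∏ v ∈ s, x v) =
      (c + α) * ∑ v ∈ s, x v ^ k + h * y ^ k - l * x w₀ ^ k) := by
  set B : W → ℝ := fun v => c - if v = w₀ then l else 0 with hB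
  have hBpos : ∀ v, 0 < B v := fun v => by
    simp only [hB]; split_ifs <;> linarith
  have hprod : (h - α) * ∏ v ∈ s, B v = (1 - α) ^ k := by
    rw [← Finset.mul_prod_erase _ _ hw₀]
    have h1 : B w₀ = c - l := by simp [hB]
    have h2 : ∏ v ∈ s.erase w₀, B v = c ^ (k - 2) := by
      rw [Finset.prod_congr rfl (g := fun _ => c) fun v hv => by
        simp [hB, Finset.ne_of_mem_erase hv], Finset.prod_const, Finset.card_erase_of_mem hw₀]
      congr 1
      omega
    rw [h1, h2, ← mul_assoc, hlabel, hK]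
  have hy0 : 0 ≤ y := hy₀.trans hy
  obtain ⟨hle, hiff⟩ := amgm_edge hs hy0 (β := h - α) (by linarith) (γ := 1 - α) (by linarith) hx
    (fun v _ => (hBpos v).le) hprod
  have hsum : ∑ v ∈ s, B v * x v ^ k = c * ∑ v ∈ s, x v ^ k - l * x w₀ ^ k := by
    simp only [hB, sub_mul, Finset.sum_sub_distrib, ← Finset.mul_sum, ite_mul, zero_mul]
    rw [Finset.sum_ite_eq' s w₀, if_pos hw₀]
  rw [hsum] at hle hiff
  have hP : 0 ≤ ∏ v ∈ s, x v := Finset.prod_nonneg hx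
  have hk0 : (0 : ℝ) < (1 - α) * k := mul_pos (by linarith) (by positivity)
  have hpow : y₀ ^ k ≤ y ^ k := pow_le_pow_left₀ hy₀ hy k
  have hm1 : α * y₀ ^ k ≤ α * y ^ k := mul_le_mul_of_nonneg_left hpow hα0
  have hm2 : (1 - α) * k * (y₀ * ∏ v ∈ s, x v) ≤ (1 - α) * k * (y * ∏ v ∈ s, x v) :=
    mul_le_mul_of_nonneg_left (mul_le_mul_of_nonneg_right hy hP) hk0.le
  refine ⟨by linarith, fun heq hypos => ?_, fun hyy hall => ?_⟩
  · have htight := hiff.1 (by linarith)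
    have hxpos : ∀ v ∈ s, 0 < x v := by
      intro v hv
      have h1 := htight v hv
      have h2 : 0 < (h - α) * y ^ k := mul_pos (by linarith) (by positivity)
      refine lt_of_le_of_ne (hx v hv) fun h0 => ?_
      rw [← h0, zero_pow (by omega), mul_zero] at h1
      linarith
    have hPpos : 0 < ∏ v ∈ s, x v := Finset.prod_pos hxpos
    constructor
    · have h1 : (1 - α) * k * (y₀ * ∏ v ∈ s, x v) = (1 - α) * k * (y * ∏ v ∈ s, x v) := by
        linarith
      exact mul_right_cancel₀ hPpos.ne' (mul_left_cancel₀ hk0.ne' h1)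
    · intro v hv
      refine ⟨hxpos v hv, fun hlt => lt_of_pow_lt_pow_left₀ k hypos.le ?_⟩
      have h1 := htight v hv
      -- Equality means B_v x_v^k = (h − α) y^k, so the larger weight belongs to the smaller value.
      have h2 : h - α < B v := by simp only [hB]; split_ifs <;> linarith
      have h3 : 0 < y ^ k := by positivity
      have h4 := mul_lt_mul_of_pos_right h2 h3
      rw [← h1] at h4
      exact lt_of_mul_lt_mul_left h4 (hBpos v).le
  · have := hiff.2 hall
    rw [hyy]
    linarith

end AmGm

/-! ### Labellings of rooted hypertrees -/

/-- The edges `E` of a hypertree with root `u`: `near e` is the vertex of `e` nearest to the root,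
and all other vertices of `e` are its children. In `e`, the nearest vertex, which may be replaced
by the vertex `top e`, has the label `h e`, the child `low e` has the label `c + α - l e`, and all
other vertices have the label `c + α`. The total label of the root is `τ`, and it is at most
`c + α` for all other vertices. -/
structure IsLabelling {W : Type*} [DecidableEq W] (α K c τ : ℝ) (k : ℕ) (E : Finset (Finset W))
    (u : W) (near top low : Finset W → W) (h l : Finset W → ℝ) (rank : Finset W → ℕ) : Prop where
  card_eq : ∀ e ∈ E, e.card = k
  near_mem : ∀ e ∈ E, near e ∈ e
  root : ∀ e ∈ E, u ∉ e.erase (near e)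
  exists_child : ∀ w, w ≠ u → ∃ e ∈ E, w ∈ e.erase (near e)
  child_unique : ∀ e ∈ E, ∀ f ∈ E, ∀ w, w ∈ e.erase (near e) → w ∈ f.erase (near f) → e = f
  low_mem : ∀ e ∈ E, low e ∈ e.erase (near e)
  top_eq : ∀ e ∈ E, top e = u ∨
    top e = near e ∧ ∃ f ∈ E, rank f < rank e ∧ top e ∈ f.erase (near f)
  label_eq : ∀ e ∈ E, (h e - α) * (c - l e) = K
  lt_h : ∀ e ∈ E, α < h e
  l_nonneg : ∀ e ∈ E, 0 ≤ l e
  l_lt : ∀ e ∈ E, l e < c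
  total : ∀ X : W → ℝ, ∑ e ∈ E, (h e * X (top e) - l e * X (low e)) = τ * X u

namespace IsLabelling

variable {W : Type*} [DecidableEq W] {α K c τ : ℝ} {k : ℕ} {E : Finset (Finset W)}
  {u : W} {near top low : Finset W → W} {h l : Finset W → ℝ} {rank : Finset W → ℕ}

theorem sum_children [Fintype W] (H : IsLabelling α K c τ k E u near top low h l rank)
    (X : W → ℝ) : ∑ e ∈ E, ∑ v ∈ e.erase (near e), X v = ∑ v, X v - X u := by
  rw [← Finset.sum_biUnion]
  · rw [eq_sub_iff_add_eq, add_comm, ← Finset.sum_insert (s := E.biUnion _)]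
    · congr 1
      ext w
      simp only [Finset.mem_insert, Finset.mem_biUnion, Finset.mem_univ, iff_true]
      by_cases hw : w = u
      · exact Or.inl hw
      · exact Or.inr (H.exists_child w hw)
    · rw [Finset.mem_biUnion]
      rintro ⟨e, he, hu⟩
      exact H.root e he hu
  · intro e he f hf hef
    rw [Function.onFun, Finset.disjoint_left]
    intro w hw hw'
    exact hef (H.child_unique e he f hf w hw hw')

theorem sum_bound [Fintype W] (H : IsLabelling α K c τ k E u near top low h l rank)
    (X : W → ℝ) : ∑ e ∈ E, ((c + α) * ∑ v ∈ e.erase (near e), X v + h e * X (top e) -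
      l e * X (low e)) = (c + α) * (∑ v, X v - X u) + τ * X u := by
  rw [← H.sum_children, ← H.total, Finset.mul_sum, ← Finset.sum_add_distrib]
  exact Finset.sum_congr rfl fun e _ => by ring

theorem edgeForm_eq (H : IsLabelling α K c τ k E u near top low h l rank) (x : W → ℝ) :
    edgeForm α k E x = ∑ e ∈ E, (α * (x (near e) ^ k + ∑ v ∈ e.erase (near e), x v ^ k) +
      (1 - α) * k * (x (near e) * ∏ v ∈ e.erase (near e), x v)) := by
  refine Finset.sum_congr rfl fun e he => ?_
  rw [Finset.add_sum_erase _ (fun v => x v ^ k) (H.near_mem e he),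
    Finset.mul_prod_erase _ x (H.near_mem e he)]

theorem near_le_top (H : IsLabelling α K c τ k E u near top low h l rank) {x : W → ℝ}
    (hu : ∀ v, x v ≤ x u) {e : Finset W} (he : e ∈ E) : x (near e) ≤ x (top e) := by
  rcases H.top_eq e he with h | ⟨h, -⟩
  · rw [h]; exact hu _
  · rw [h]

theorem card_erase (H : IsLabelling α K c τ k E u near top low h l rank) (hk : 2 ≤ k)
    {e : Finset W} (he : e ∈ E) : (e.erase (near e)).card + 1 = k := by
  rw [Finset.card_erase_of_mem (H.near_mem e he), H.card_eq e he]
  omega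

/-- The maximality of `x` at `u` serves only to raise the value at `near e` to that at `top e`. -/
theorem edgeForm_le [Fintype W] (H : IsLabelling α K c τ k E u near top low h l rank) (hk : 2 ≤ k)
    (hα0 : 0 ≤ α) (hα1 : α < 1) (hc : 0 < c) (hK : K * c ^ (k - 2) = (1 - α) ^ k) {x : W → ℝ}
    (hx : ∀ v, 0 ≤ x v) (hu : ∀ v, x v ≤ x u) :
    edgeForm α k E x ≤ (c + α) * (∑ v, x v ^ k - x u ^ k) + τ * x u ^ k := by
  rw [H.edgeForm_eq, ← H.sum_bound fun v => x v ^ k]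
  exact Finset.sum_le_sum fun e he => (edge_bound hk hα0 hα1 hc hK (H.lt_h e he) (H.l_nonneg e he)
    (H.l_lt e he) (H.label_eq e he) (H.card_erase hk he) (H.low_mem e he) (fun v _ => hx v)
    (hx _) (H.near_le_top hu he)).1

/-- Equality holds in every edge, so values drop strictly from `top e` to the children and `u` is
the only maximum. Since `near e` and `top e` have equal values, an edge charged to `u` has `u` as
its nearest vertex. -/
theorem top_eq_near_of_eq [Fintype W] (H : IsLabelling α K c τ k E u near top low h l rank)
    (hk : 2 ≤ k) (hα0 : 0 ≤ α) (hα1 : α < 1) (hc : 0 < c) (hK : K * c ^ (k - 2) = (1 - α) ^ k)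
    (hlt : ∀ e ∈ E, h e + l e < c + α) {x : W → ℝ} (hx : ∀ v, 0 ≤ x v) (hu : ∀ v, x v ≤ x u)
    (hu0 : 0 < x u)
    (heq : edgeForm α k E x = (c + α) * (∑ v, x v ^ k - x u ^ k) + τ * x u ^ k) :
    ∀ e ∈ E, top e = near e := by
  have hb := fun e he => edge_bound hk hα0 hα1 hc hK (H.lt_h e he) (H.l_nonneg e he)
    (H.l_lt e he) (H.label_eq e he) (H.card_erase hk he) (H.low_mem e he) (fun v _ => hx v)
    (hx _) (H.near_le_top hu he)
  rw [H.edgeForm_eq, ← H.sum_bound fun v => x v ^ k] at heq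
  have htight := (Finset.sum_eq_sum_iff_of_le fun e he => (hb e he).1).1 heq
  have hchild : ∀ n, ∀ e ∈ E, rank e = n → 0 < x (top e) ∧
      ∀ v ∈ e.erase (near e), 0 < x v ∧ x v < x (top e) := by
    intro n
    induction n using Nat.strong_induction_on with
    | _ n ih =>
      rintro e he rfl
      have htop : 0 < x (top e) := by
        rcases H.top_eq e he with h | ⟨-, f, hf, hfe, htf⟩
        · rwa [h]
        · exact ((ih _ hfe f hf rfl).2 _ htf).1
      exact ⟨htop, fun v hv =>
        ⟨(((hb e he).2.1 (htight e he) htop).2 v hv).1,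
          (((hb e he).2.1 (htight e he) htop).2 v hv).2 (hlt e he)⟩⟩
  intro e he
  rcases H.top_eq e he with h | ⟨h, -⟩
  · have hne := ((hb e he).2.1 (htight e he) (hchild _ e he rfl).1).1
    rw [h] at hne ⊢
    by_contra hcon
    obtain ⟨f, hf, hw⟩ := H.exists_child (near e) (Ne.symm hcon)
    have h1 := ((hchild _ f hf rfl).2 _ hw).2
    have h2 := hu (top f)
    linarith
  · exact h

/-- The equality case of AM–GM determines the `k`-th powers at the children from the one at the
nearest vertex, so the vector is built outwards from the root in the order of `rank`. -/
theorem exists_edgeForm_eq [Fintype W] (H : IsLabelling α K c τ k E u near top low h l rank)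
    (hk : 2 ≤ k) (hα0 : 0 ≤ α) (hα1 : α < 1) (hc : 0 < c) (hK : K * c ^ (k - 2) = (1 - α) ^ k)
    (htop : ∀ e ∈ E, top e = near e) :
    ∃ x : W → ℝ, (∀ v, 0 < x v) ∧
      edgeForm α k E x = (c + α) * (∑ v, x v ^ k - x u ^ k) + τ * x u ^ k := by
  have hBpos : ∀ e ∈ E, ∀ w, 0 < c - if w = low e then l e else 0 := by
    intro e he w
    have := H.l_lt e he
    split_ifs <;> linarith
  have grow : ∀ n, ∃ X : W → ℝ, (∀ v, 0 < X v) ∧ ∀ e ∈ E, rank e < n → ∀ v ∈ e.erase (near e),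
      (c - if v = low e then l e else 0) * X v = (h e - α) * X (top e) := by
    intro n
    induction n with
    | zero => exact ⟨fun _ => 1, fun _ => one_pos, fun e _ hn => absurd hn (by omega)⟩
    | succ n ih =>
      obtain ⟨X, hX0, hX⟩ := ih
      have hex : ∀ w, ∃ t : ℝ, 0 < t ∧
          (∀ e ∈ E, rank e = n → w ∈ e.erase (near e) →
            (c - if w = low e then l e else 0) * t = (h e - α) * X (top e)) ∧
          ((∀ e ∈ E, w ∈ e.erase (near e) → rank e ≠ n) → t = X w) := by
        intro w
        by_cases hw : ∃ e ∈ E, rank e = n ∧ w ∈ e.erase (near e)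
        · obtain ⟨e, he, hen, hwe⟩ := hw
          have hB := hBpos e he w
          refine ⟨(h e - α) * X (top e) / (c - if w = low e then l e else 0),
            div_pos (mul_pos (sub_pos.2 (H.lt_h e he)) (hX0 _)) hB, ?_, fun hcon =>
            absurd hen (hcon e he hwe)⟩
          intro f hf _ hwf
          rw [← H.child_unique e he f hf w hwe hwf]
          exact mul_div_cancel₀ _ hB.ne'
        · refine ⟨X w, hX0 w, fun e he hen hwe => absurd ⟨e, he, hen, hwe⟩ hw, fun _ => rfl⟩
      choose Y hY0 hY1 hY2 using hex
      have hYtop : ∀ e ∈ E, rank e ≤ n → Y (top e) = X (top e) := by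
        intro e he hen
        refine hY2 _ fun f hf hmem => ?_
        rcases H.top_eq e he with h | ⟨-, f', hf', hlt, hmem'⟩
        · exact absurd (h ▸ hmem) (H.root f hf)
        · rw [← H.child_unique f' hf' f hf _ hmem' hmem]
          omega
      refine ⟨Y, hY0, fun e he hen v hv => ?_⟩
      rw [hYtop e he (by omega)]
      by_cases hrn : rank e = n
      · exact hY1 v e he hrn hv
      · rw [hY2 v fun f hf hmem => ?_]
        · exact hX e he (by omega) v hv
        · rwa [H.child_unique f hf e he v hmem hv]
  obtain ⟨X, hX0, hX⟩ := grow (E.sup rank + 1)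
  set x : W → ℝ := fun v => X v ^ ((k : ℝ)⁻¹) with hxdef
  have hx0 : ∀ v, 0 < x v := fun v => Real.rpow_pos_of_pos (hX0 v) _
  have hxk : ∀ v, x v ^ k = X v := fun v => Real.rpow_inv_natCast_pow (hX0 v).le (by omega)
  refine ⟨x, hx0, ?_⟩
  rw [H.edgeForm_eq, ← H.sum_bound fun v => x v ^ k]
  refine Finset.sum_congr rfl fun e he => ?_
  refine (edge_bound hk hα0 hα1 hc hK (H.lt_h e he) (H.l_nonneg e he)
    (H.l_lt e he) (H.label_eq e he) (H.card_erase hk he) (H.low_mem e he) (fun v _ => (hx0 v).le)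
    (hx0 _).le (by rw [htop e he])).2.2 (by rw [htop e he]) fun v hv => ?_
  rw [hxk, hxk]
  exact hX e he (Nat.lt_succ_of_le (Finset.le_sup he)) v hv

end IsLabelling

/-! ### The labelling belonging to a path -/

/-- A rooted hypertree with the edges `E`, in which `v 0, e 0, v 1, …, e (d - 1), v d` is a path
that approaches the root up to its `i`-th vertex and then departs from it. -/
structure IsRootedPath {W : Type*} [DecidableEq W] (E : Finset (Finset W)) (u : W)
    (near : Finset W → W) (v : ℕ → W) (e : ℕ → Finset W) (d i : ℕ) : Prop where
  near_mem : ∀ f ∈ E, near f ∈ f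
  root : ∀ f ∈ E, u ∉ f.erase (near f)
  exists_child : ∀ w, w ≠ u → ∃ f ∈ E, w ∈ f.erase (near f)
  child_unique : ∀ f ∈ E, ∀ f' ∈ E, ∀ w, w ∈ f.erase (near f) → w ∈ f'.erase (near f') → f = f'
  le : i ≤ d
  mem : ∀ j < d, e j ∈ E
  inj : ∀ j < d, ∀ j' < d, e j = e j' → j = j'
  left_child : ∀ j < i, v j ∈ (e j).erase (near (e j))
  left_near : ∀ j, j + 1 < i → near (e j) = v (j + 1)
  right_child : ∀ j, i ≤ j → j < d → v (j + 1) ∈ (e j).erase (near (e j))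
  right_near : ∀ j, i ≤ j → j < d → near (e j) = v j

/-- A path edge with j path edges beyond it has the label g_{j+1} towards the turn, and its other
path vertex gives up g_j, exactly what the next edge uses there. The edges at the turn and those off
the path are charged to `u`, wherever their nearest vertex is. -/
theorem IsRootedPath.exists_isLabelling {W : Type*} [DecidableEq W] {E : Finset (Finset W)}
    {u : W} {near : Finset W → W} {v : ℕ → W} {e : ℕ → Finset W} {d i : ℕ}
    (H : IsRootedPath E u near v e d i) {k : ℕ} (hk : 2 ≤ k) (hE : ∀ f ∈ E, f.card = k)
    {α K c : ℝ} (hα : 0 ≤ α) (hK : 0 < K) (hc : 0 < c) (hg : ∀ j < d, branchLabel α K c j < c) :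
    ∃ (top low : Finset W → W) (h l : Finset W → ℝ) (rank : Finset W → ℕ),
      IsLabelling α K c (branchLabel α K c i + branchLabel α K c (d - i) +
        (E.card - d : ℕ) * branchLabel α K c 1) k E u near top low h l rank ∧
      (∀ f ∈ E, ∃ j, (j = 0 ∨ j < i ∨ j < d - i) ∧ h f = branchLabel α K c (j + 1) ∧
        l f = branchLabel α K c j) ∧
      ((∀ f ∈ E, top f = near f) ↔ (∀ f ∈ E, (∀ j < d, f ≠ e j) → near f = u) ∧
        (0 < i → near (e (i - 1)) = u) ∧ (i < d → near (e i) = u)) := by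
  classical
  set g := branchLabel α K c with hgdef
  -- The position on the path, with `d` for the edges off it.
  have hpos : ∃ pos : Finset W → ℕ, (∀ j < d, pos (e j) = j) ∧
      ∀ f, (∀ j < d, f ≠ e j) → pos f = d := by
    refine ⟨fun f => if h : ∃ j < d, f = e j then h.choose else d, fun j hj => ?_, fun f hf => ?_⟩
    · have h : ∃ j' < d, e j = e j' := ⟨j, hj, rfl⟩
      simp only [dif_pos h]
      exact (H.inj j hj _ h.choose_spec.1 h.choose_spec.2).symm
    · exact dif_neg fun ⟨j, hj, h⟩ => hf j hj h
  obtain ⟨pos, hpos, hpos'⟩ := hpos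
  have hcases : ∀ f, (∃ j < i, f = e j) ∨ (∃ j, i ≤ j ∧ j < d ∧ f = e j) ∨ ∀ j < d, f ≠ e j := by
    intro f
    by_cases hf : ∃ j < d, f = e j
    · obtain ⟨j, hj, rfl⟩ := hf
      rcases lt_or_ge j i with h | h
      · exact Or.inl ⟨j, h, rfl⟩
      · exact Or.inr (Or.inl ⟨j, h, hj, rfl⟩)
    · push Not at hf
      exact Or.inr (Or.inr hf)
  have hchild : ∀ f, ∃ w, f ∈ E → w ∈ f.erase (near f) := by
    intro f
    by_cases hf : f ∈ E
    · have : 0 < (f.erase (near f)).card := by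
        rw [Finset.card_erase_of_mem (H.near_mem f hf), hE f hf]
        omega
      obtain ⟨w, hw⟩ := Finset.card_pos.1 this
      exact ⟨w, fun _ => hw⟩
    · exact ⟨u, fun h => absurd h hf⟩
  choose ch hch using hchild
  set top : Finset W → W := fun f => if pos f < i then (if pos f + 1 = i then u else v (pos f + 1))
    else if pos f < d then (if pos f = i then u else v (pos f)) else u with htop
  set low : Finset W → W := fun f => if pos f < i then v (pos f) else
    if pos f < d then v (pos f + 1) else ch f with hlow
  set lev : Finset W → ℕ := fun f => if pos f < i then pos f else
    if pos f < d then d - 1 - pos f else 0 with hlev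
  set rank : Finset W → ℕ := fun f => if pos f < i then i - 1 - pos f else
    if pos f < d then pos f - i else 0 with hrank
  have hid := H.le
  have topL : ∀ j < i, top (e j) = if j + 1 = i then u else v (j + 1) := fun j hj => by
    simp only [htop, hpos j (hj.trans_le hid), if_pos hj]
  have topR : ∀ j, i ≤ j → j < d → top (e j) = if j = i then u else v j := fun j hj hjd => by
    simp only [htop, hpos j hjd, if_neg (not_lt.2 hj), if_pos hjd]
  have topO : ∀ f, (∀ j < d, f ≠ e j) → top f = u := fun f hf => by
    simp only [htop, hpos' f hf, if_neg (not_lt.2 hid), if_neg (lt_irrefl d)]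
  have lowL : ∀ j < i, low (e j) = v j := fun j hj => by
    simp only [hlow, hpos j (hj.trans_le hid), if_pos hj]
  have lowR : ∀ j, i ≤ j → j < d → low (e j) = v (j + 1) := fun j hj hjd => by
    simp only [hlow, hpos j hjd, if_neg (not_lt.2 hj), if_pos hjd]
  have lowO : ∀ f, (∀ j < d, f ≠ e j) → low f = ch f := fun f hf => by
    simp only [hlow, hpos' f hf, if_neg (not_lt.2 hid), if_neg (lt_irrefl d)]
  have levL : ∀ j < i, lev (e j) = j := fun j hj => by
    simp only [hlev, hpos j (hj.trans_le hid), if_pos hj]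
  have levR : ∀ j, i ≤ j → j < d → lev (e j) = d - 1 - j := fun j hj hjd => by
    simp only [hlev, hpos j hjd, if_neg (not_lt.2 hj), if_pos hjd]
  have levO : ∀ f, (∀ j < d, f ≠ e j) → lev f = 0 := fun f hf => by
    simp only [hlev, hpos' f hf, if_neg (not_lt.2 hid), if_neg (lt_irrefl d)]
  have rankL : ∀ j < i, rank (e j) = i - 1 - j := fun j hj => by
    simp only [hrank, hpos j (hj.trans_le hid), if_pos hj]
  have rankR : ∀ j, i ≤ j → j < d → rank (e j) = j - i := fun j hj hjd => by
    simp only [hrank, hpos j hjd, if_neg (not_lt.2 hj), if_pos hjd]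
  have hg0 : g 0 = 0 := rfl
  have hlevlt : ∀ f, g (lev f) < c := by
    intro f
    rcases hcases f with ⟨j, hj, rfl⟩ | ⟨j, hj, hjd, rfl⟩ | hf
    · rw [levL j hj]; exact hg _ (by omega)
    · rw [levR j hj hjd]; exact hg _ (by omega)
    · rw [levO f hf, hg0]; exact hc
  have hgnn : ∀ f, 0 ≤ g (lev f) := by
    intro f
    have key : ∀ j < d, 0 ≤ g j := by
      intro j hj
      rcases j with _ | j
      · exact le_rfl
      · exact hα.trans (alpha_lt_branchLabel hK (hg j (by omega))).le
    rcases hcases f with ⟨j, hj, rfl⟩ | ⟨j, hj, hjd, rfl⟩ | hf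
    · rw [levL j hj]; exact key _ (by omega)
    · rw [levR j hj hjd]; exact key _ (by omega)
    · rw [levO f hf, hg0]
  refine ⟨top, low, fun f => g (lev f + 1), fun f => g (lev f), rank, ⟨hE, H.near_mem, H.root,
    H.exists_child, H.child_unique, ?_, ?_, fun f _ => branchLabel_succ_mul (hlevlt f),
    fun f _ => alpha_lt_branchLabel hK (hlevlt f), fun f _ => hgnn f, fun f _ => hlevlt f, ?_⟩,
    fun f _ => ⟨lev f, ?_, rfl, rfl⟩, ?_⟩
  · intro f hf
    rcases hcases f with ⟨j, hj, rfl⟩ | ⟨j, hj, hjd, rfl⟩ | hf'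
    · rw [lowL j hj]; exact H.left_child j hj
    · rw [lowR j hj hjd]; exact H.right_child j hj hjd
    · rw [lowO f hf']; exact hch f hf
  · intro f hf
    rcases hcases f with ⟨j, hj, rfl⟩ | ⟨j, hj, hjd, rfl⟩ | hf'
    · rw [topL j hj]
      by_cases hji : j + 1 = i
      · exact Or.inl (if_pos hji)
      · have hji' : j + 1 < i := by omega
        refine Or.inr ⟨by rw [if_neg hji, H.left_near j hji'], e (j + 1), H.mem _ (by omega), ?_, ?_⟩
        · rw [rankL j hj, rankL _ hji']; omega
        · rw [if_neg hji]; exact H.left_child _ hji'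
    · rw [topR j hj hjd]
      by_cases hji : j = i
      · exact Or.inl (if_pos hji)
      · obtain ⟨j, rfl⟩ : ∃ j', j = j' + 1 := ⟨j - 1, by omega⟩
        refine Or.inr ⟨by rw [if_neg hji, H.right_near _ hj hjd], e j, H.mem _ (by omega), ?_, ?_⟩
        · rw [rankR _ hj hjd, rankR j (by omega) (by omega)]; omega
        · rw [if_neg hji]; exact H.right_child _ (by omega) (by omega)
    · exact Or.inl (topO f hf')
  · intro X
    have hspine : (Finset.range d).image e ⊆ E := by
      intro f hf
      obtain ⟨j, hj, rfl⟩ := Finset.mem_image.1 hf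
      exact H.mem j (Finset.mem_range.1 hj)
    have hinj : Set.InjOn e (Finset.range d) := fun j hj j' hj' h =>
      H.inj j (by simpa using hj) j' (by simpa using hj') h
    -- Each edge off the path gives g_1 X(u). With `u` in place of `v i`, the two parts of the path
    -- telescope to g_i X(u) and g_{d−i} X(u).
    rw [← Finset.sum_sdiff hspine, Finset.sum_image hinj]
    have hoff : ∑ f ∈ E \ (Finset.range d).image e, (g (lev f + 1) * X (top f) -
        g (lev f) * X (low f)) = (E.card - d : ℕ) * g 1 * X u := by
      rw [Finset.sum_congr rfl (g := fun _ => g 1 * X u), Finset.sum_const, nsmul_eq_mul,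
        Finset.card_sdiff_of_subset hspine, Finset.card_image_of_injOn hinj, Finset.card_range,
        mul_assoc]
      intro f hf
      have hf' : ∀ j < d, f ≠ e j := fun j hj h =>
        (Finset.mem_sdiff.1 hf).2 (Finset.mem_image.2 ⟨j, Finset.mem_range.2 hj, h.symm⟩)
      rw [topO f hf', levO f hf', hg0, zero_mul, sub_zero]
    have hd : d = i + (d - i) := by omega
    have hL : ∑ j ∈ Finset.range i, (g (lev (e j) + 1) * X (top (e j)) -
        g (lev (e j)) * X (low (e j))) = g i * X u := by
      have htel := Finset.sum_range_sub (fun j => g j * X (if j < i then v j else u)) i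
      refine (Finset.sum_congr rfl ?_).trans (htel.trans ?_)
      · intro j hj
        have hj := Finset.mem_range.1 hj
        simp only [topL j hj, lowL j hj, levL j hj, if_pos hj]
        by_cases hji : j + 1 = i
        · rw [if_pos hji, if_neg (by omega)]
        · rw [if_neg hji, if_pos (by omega)]
      · simp [hg0]
    have hR : ∑ t ∈ Finset.range (d - i), (g (lev (e (i + t)) + 1) * X (top (e (i + t))) -
        g (lev (e (i + t))) * X (low (e (i + t)))) = g (d - i) * X u := by
      have htel := Finset.sum_range_sub'
        (fun t => g (d - i - t) * X (if t = 0 then u else v (i + t))) (d - i)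
      refine (Finset.sum_congr rfl ?_).trans (htel.trans ?_)
      · intro t ht
        have ht := Finset.mem_range.1 ht
        simp only [topR (i + t) (by omega) (by omega), lowR (i + t) (by omega) (by omega),
          levR (i + t) (by omega) (by omega)]
        rw [show d - 1 - (i + t) + 1 = d - i - t by omega,
          show d - 1 - (i + t) = d - i - (t + 1) by omega, if_neg (Nat.succ_ne_zero t),
          show i + t + 1 = i + (t + 1) by omega]
        by_cases ht0 : t = 0
        · rw [if_pos (by omega), if_pos ht0]
        · rw [if_neg (by omega), if_neg ht0]
      · simp [hg0]
    have hsplit : ∑ j ∈ Finset.range d, (g (lev (e j) + 1) * X (top (e j)) -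
        g (lev (e j)) * X (low (e j))) = g i * X u + g (d - i) * X u := by
      rw [hd, Finset.sum_range_add, hL, hR, ← hd]
    rw [hoff, hsplit]
    ring
  · rcases hcases f with ⟨j, hj, rfl⟩ | ⟨j, hj, hjd, rfl⟩ | hf
    · rw [levL j hj]; omega
    · rw [levR j hj hjd]; omega
    · exact Or.inl (levO f hf)
  · constructor
    · intro h
      refine ⟨fun f hf hf' => ?_, fun hi => ?_, fun hi => ?_⟩
      · rw [← h f hf, topO f hf']
      · rw [← h _ (H.mem _ (by omega)), topL _ (by omega), if_pos (by omega)]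
      · rw [← h _ (H.mem _ hi), topR _ le_rfl hi, if_pos rfl]
    · rintro ⟨h1, h2, h3⟩ f hf
      rcases hcases f with ⟨j, hj, rfl⟩ | ⟨j, hj, hjd, rfl⟩ | hf'
      · rw [topL j hj]
        by_cases hji : j + 1 = i
        · rw [if_pos hji, ← h2 (by omega)]
          congr 2
          omega
        · rw [if_neg hji, H.left_near j (by omega)]
      · rw [topR j hj hjd]
        by_cases hji : j = i
        · rw [if_pos hji, hji, h3 (by omega)]
        · rw [if_neg hji, H.right_near j hj hjd]
      · rw [topO f hf', h1 f hf hf']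

/-! ### Rooted paths from hypertrees -/

namespace Hypergraph

variable {V : Type*} {G : Hypergraph V} [Fintype G.vertexSet] [DecidableEq G.vertexSet]

theorem IsHypertree.exists_isRootedPath (hG : G.IsHypertree) (hfin : G.edgeSet.Finite)
    (hne : ∀ e ∈ G.edgeSet, e.Nonempty) (u : G.vertexSet) {d : ℕ} {v : Fin (d + 1) → V}
    {e : Fin d → Set V} (hp : G.IsPath d v e) :
    ∃ (near : Finset G.vertexSet → G.vertexSet) (v' : ℕ → G.vertexSet)
      (e' : ℕ → Finset G.vertexSet) (i : ℕ), IsRootedPath G.edgeFinset u near v' e' d i ∧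
      (∀ j : Fin (d + 1), (v' j : V) = v j) ∧
      ∀ j : Fin d, Subtype.val '' (e' j : Set G.vertexSet) = e j := by
  obtain ⟨r, hr⟩ := hG.exists_isRooting hfin hne u.2
  have hnear : ∀ f : Finset G.vertexSet, ∃ w : G.vertexSet, f ∈ G.edgeFinset →
      (w : V) = r (Subtype.val '' (f : Set G.vertexSet)) := by
    intro f
    by_cases hf : f ∈ G.edgeFinset
    · have hf' := mem_edgeFinset.1 hf
      exact ⟨⟨_, G.subset_vertexSet_of_mem_edgeSet' hf' (hr.mem _ hf')⟩, fun _ => rfl⟩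
    · exact ⟨u, fun h => absurd h hf⟩
  choose near hnear using hnear
  choose e0 he0 he0' using fun j => exists_mem_edgeFinset (hp.1.2 j).1
  obtain ⟨i, hi, h1, h2, h3⟩ := hr.exists_turn hp
  set v' : ℕ → G.vertexSet := fun j =>
    if hj : j < d + 1 then ⟨v ⟨j, hj⟩, hp.1.1 _⟩ else u with hv'
  set e' : ℕ → Finset G.vertexSet := fun j => if hj : j < d then e0 ⟨j, hj⟩ else ∅ with he'
  have hvj : ∀ j : Fin (d + 1), (v' j : V) = v j := fun j => by
    simp only [hv', dif_pos j.2]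
  have hej : ∀ j : Fin d, e' j = e0 j := fun j => by simp [he']
  have hee : ∀ j : Fin d, Subtype.val '' (e' j : Set G.vertexSet) = e j := fun j => by
    rw [hej, he0']
  have hmem : ∀ j (hj : j < d), e' j ∈ G.edgeFinset := fun j hj => by
    have := hej ⟨j, hj⟩
    rw [this]
    exact he0 _
  have hchild : ∀ f ∈ G.edgeFinset, ∀ w : G.vertexSet, w ∈ f.erase (near f) ↔
      (w : V) ∈ Subtype.val '' (f : Set G.vertexSet) ∧
        (w : V) ≠ r (Subtype.val '' (f : Set G.vertexSet)) := by
    intro f hf w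
    rw [Finset.mem_erase, ← hnear f hf, and_comm]
    exact and_congr (by simp) (not_congr Subtype.ext_iff)
  have hne' : ∀ j (hj : j < d), (near (e' j) : V) = r (e ⟨j, hj⟩) := fun j hj => by
    rw [hnear _ (hmem j hj), hee ⟨j, hj⟩]
  have hc : ∀ j (hj : j < d) (w : G.vertexSet), w ∈ (e' j).erase (near (e' j)) ↔
      (w : V) ∈ e ⟨j, hj⟩ ∧ (w : V) ≠ r (e ⟨j, hj⟩) := fun j hj w => by
    rw [hchild _ (hmem j hj), hee ⟨j, hj⟩]
  refine ⟨near, v', e', i, ⟨?_, ?_, ?_, ?_, hi, hmem, ?_, ?_, ?_, ?_, ?_⟩, hvj, hee⟩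
  · intro f hf
    have := hr.mem _ (mem_edgeFinset.1 hf)
    rw [← hnear f hf] at this
    simpa using this
  · intro f hf hu
    obtain ⟨h4, h5⟩ := (hchild f hf u).1 hu
    exact h5 (hr.root _ (mem_edgeFinset.1 hf) h4).symm
  · intro w hw
    obtain ⟨f, hf, hwf, hwr⟩ := hr.exists_child w w.2 (fun h => hw (Subtype.ext h))
    obtain ⟨f', hf', rfl⟩ := exists_mem_edgeFinset hf
    exact ⟨f', hf', (hchild f' hf' w).2 ⟨hwf, hwr⟩⟩
  · intro f hf f' hf' w hw hw'
    obtain ⟨h4, h5⟩ := (hchild f hf w).1 hw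
    obtain ⟨h6, h7⟩ := (hchild f' hf' w).1 hw'
    exact image_val_injective (hr.child_unique _ (mem_edgeFinset.1 hf) _ (mem_edgeFinset.1 hf') w
      h4 h5 h6 h7)
  · intro j hj j' hj' h
    have h4 := hee ⟨j, hj⟩
    have h5 := hee ⟨j', hj'⟩
    simp only at h4 h5
    rw [h, h5] at h4
    simpa using (hp.2.2 h4).symm
  · intro j hj
    have hjd : j < d := by omega
    have hv := hvj (Fin.castSucc ⟨j, hjd⟩)
    simp only [Fin.val_castSucc] at hv
    rw [hc j hjd, hv]
    exact ⟨(hp.1.2 ⟨j, hjd⟩).2.1, h1 ⟨j, hjd⟩ hj⟩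
  · intro j hj
    have hjd : j < d := by omega
    have hv := hvj (Fin.succ ⟨j, hjd⟩)
    simp only [Fin.val_succ] at hv
    rw [Subtype.ext_iff, hne' j hjd, hv]
    exact h2 ⟨j, hjd⟩ hj
  · intro j hj hjd
    have hv := hvj (Fin.succ ⟨j, hjd⟩)
    simp only [Fin.val_succ] at hv
    rw [hc j hjd, hv, h3 ⟨j, hjd⟩ hj]
    exact ⟨(hp.1.2 ⟨j, hjd⟩).2.2.1, (hp.1.2 ⟨j, hjd⟩).2.2.2.symm⟩
  · intro j hj hjd
    have hv := hvj (Fin.castSucc ⟨j, hjd⟩)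
    simp only [Fin.val_castSucc] at hv
    rw [Subtype.ext_iff, hne' j hjd, hv]
    exact h3 ⟨j, hjd⟩ hj

end Hypergraph

/-! ### Balanced labels -/

/-- The labels of a path with `d` edges, to whose vertex in the middle `n` pendant edges are
attached, have the total `c + α` at this vertex, and the total is not larger at any other vertex
to which the pendant edges could be attached instead. -/
structure IsBalanced (α K c : ℝ) (k d n : ℕ) : Prop where
  c_pos : 0 < c
  K_pos : 0 < K
  K_eq : K * c ^ (k - 2) = (1 - α) ^ k
  lt : ∀ j < d, branchLabel α K c j < c
  sum_eq : branchLabel α K c (d / 2) + branchLabel α K c (d - d / 2) + n * branchLabel α K c 1 =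
    c + α
  le : ∀ i ≤ d, branchLabel α K c i + branchLabel α K c (d - i) ≤
    branchLabel α K c (d / 2) + branchLabel α K c (d - d / 2)
  lt_of_ne : 0 < n → ∀ i ≤ d, i ≠ d / 2 → i ≠ d - d / 2 →
    branchLabel α K c i + branchLabel α K c (d - i) <
      branchLabel α K c (d / 2) + branchLabel α K c (d - d / 2)
  sum_lt : 0 < n → branchLabel α K c (d / 2) + branchLabel α K c (d - d / 2) < c + α
  mono : ∀ i j, i ≤ j → j ≤ d → branchLabel α K c i ≤ branchLabel α K c j

theorem exists_isBalanced {α : ℝ} (hα0 : 0 ≤ α) (hα1 : α < 1) {k d : ℕ} (hk : 2 ≤ k) (hd : 2 ≤ d)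
    (n : ℕ) : ∃ c K, IsBalanced α K c k d n := by
  -- The branches there have p + 1 and q + 1 edges; `2 ≤ d` makes both halves nonempty.
  obtain ⟨c, K, hc, hK, hKc, hlt, hsum⟩ := exists_branchLabel_balance hα0 hα1 (k - 2) (d / 2 - 1)
    (d - d / 2 - 1) n (by omega)
  rw [show d / 2 - 1 + 1 = d / 2 by omega, show d - d / 2 - 1 + 1 = d - d / 2 by omega] at hsum
  rw [show k - 2 + 2 = k by omega] at hKc
  have hg1 : 0 < branchLabel α K c 1 := hα0.trans_lt (alpha_lt_branchLabel hK (hlt 0 (by omega)))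
  have hn0 : 0 ≤ n * branchLabel α K c 1 := by positivity
  have hadd := fun t (ht : t ≤ d / 2) => branchLabel_add_le hα0 hK (p := d / 2) (q := d - d / 2)
    (by omega) (by omega) (fun i hi => hlt i (by omega)) (by linarith) ht
  -- Moving the root all the way to an end extends the bound from half the path to all of it.
  have hltd : ∀ j < d, branchLabel α K c j < c := fun j hj =>
    (hadd (d / 2) le_rfl).1 j (by omega)
  have hsumlt : 0 < n → branchLabel α K c (d / 2) + branchLabel α K c (d - d / 2) < c + α := by
    intro hn
    have : 0 < n * branchLabel α K c 1 := by positivity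
    linarith
  refine ⟨c, K, hc, hK, hKc, hltd, hsum, fun i hi => ?_, fun hn i hi h1 h2 => ?_, hsumlt,
    fun i j hij hj => ?_⟩
  · rcases le_or_gt i (d / 2) with h | h
    · have := (hadd (d / 2 - i) (by omega)).2.1
      rwa [show d / 2 - (d / 2 - i) = i by omega,
        show d - d / 2 + (d / 2 - i) = d - i by omega] at this
    · by_cases h' : i = d - d / 2
      · rw [h', show d - (d - d / 2) = d / 2 by omega, add_comm]
      · have := (hadd (d / 2 - (d - i)) (by omega)).2.1
        rwa [show d / 2 - (d / 2 - (d - i)) = d - i by omega,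
          show d - d / 2 + (d / 2 - (d - i)) = i by omega, add_comm] at this
  · rcases le_or_gt i (d / 2) with h | h
    · have := (hadd (d / 2 - i) (by omega)).2.2 (by omega) (hsumlt hn)
      rwa [show d / 2 - (d / 2 - i) = i by omega,
        show d - d / 2 + (d / 2 - i) = d - i by omega] at this
    · have := (hadd (d / 2 - (d - i)) (by omega)).2.2 (by omega) (hsumlt hn)
      rwa [show d / 2 - (d / 2 - (d - i)) = d - i by omega,
        show d - d / 2 + (d / 2 - (d - i)) = i by omega, add_comm] at this
  · induction j, hij using Nat.le_induction with
    | base => exact le_rfl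
    | succ j hij ih =>
      exact (ih (by omega)).trans
        (branchLabel_lt_succ hα0 hK fun i hi => hltd i (by omega)).le

/-! ### Comparison with the broom, and the theorem -/

namespace Hypergraph

variable {V : Type*} {G : Hypergraph V}

theorem IsUniform.nonempty {k : ℕ} (hu : G.IsUniform k) (hk : 2 ≤ k) :
    ∀ e ∈ G.edgeSet, e.Nonempty := fun e he => by
  rw [← Set.ncard_pos (hu e he).1, (hu e he).2]
  omega

theorem edgeForm_le_of_isPath [Fintype G.vertexSet] {α K c : ℝ} {k d : ℕ} (hα0 : 0 ≤ α)
    (hα1 : α < 1) (hk : 2 ≤ k) (hG : G.IsHypertree) (hu : G.IsUniform k)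
    (hfin : G.edgeSet.Finite) {v : Fin (d + 1) → V} {e : Fin d → Set V} (hp : G.IsPath d v e)
    (hd : 2 ≤ d) (hB : IsBalanced α K c k d (G.edgeSet.ncard - d)) {x : G.vertexSet → ℝ}
    (hx : ∀ w, 0 ≤ x w) :
    edgeForm α k G.edgeFinset x ≤ (c + α) * ∑ w, x w ^ k ∧
    (d < G.edgeSet.ncard → x ≠ 0 → edgeForm α k G.edgeFinset x = (c + α) * ∑ w, x w ^ k →
      ∃ (v : Fin (d + 1) → V) (e : Fin d → Set V), G.IsBroomPath d v e) := by
  classical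
  have : Nonempty G.vertexSet := ⟨⟨v 0, hp.1.1 0⟩⟩
  obtain ⟨u, hmax⟩ := Finite.exists_max x
  obtain ⟨near, v', e', i, hR, hv', he'⟩ := hG.exists_isRootedPath hfin (hu.nonempty hk) u hp
  obtain ⟨top, low, h, l, rank, hL, hhl, htop⟩ := hR.exists_isLabelling hk
    (fun f hf => hu.card_eq hf) hα0 hB.K_pos hB.c_pos hB.lt
  rw [card_edgeFinset] at hL
  set τ := branchLabel α K c i + branchLabel α K c (d - i) +
    (G.edgeSet.ncard - d : ℕ) * branchLabel α K c 1 with hτ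
  have hle := hL.edgeForm_le hk hα0 hα1 hB.c_pos hB.K_eq hx hmax
  have hτle : τ ≤ c + α := by
    have h1 := hB.le i hR.le
    have h2 := hB.sum_eq
    linarith
  have hXu : 0 ≤ x u ^ k := pow_nonneg (hx u) k
  have hm := mul_le_mul_of_nonneg_right hτle hXu
  refine ⟨by linarith, fun hdm hx0 heq => ?_⟩
  have hn : 0 < G.edgeSet.ncard - d := by omega
  have hu0 : 0 < x u := by
    obtain ⟨w, hw⟩ := Function.ne_iff.1 hx0
    exact (lt_of_le_of_ne (hx w) (Ne.symm hw)).trans_le (hmax w)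
  have hXu0 : 0 < x u ^ k := by positivity
  have hτeq : τ = c + α := by
    refine le_antisymm hτle (le_of_mul_le_mul_right ?_ hXu0)
    linarith
  have hi : i = d / 2 ∨ i = d - d / 2 := by
    by_contra hcon
    push Not at hcon
    have h1 := hB.lt_of_ne hn i hR.le hcon.1 hcon.2
    have h2 := hB.sum_eq
    linarith
  -- As the turn is in the middle, the labels are g_{j+1} and g_j with j + 1 ≤ ⌈d/2⌉; the pendant
  -- edges make the sum of the two middle labels strictly less than c + α.
  have hlt : ∀ f ∈ G.edgeFinset, h f + l f < c + α := by
    intro f hf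
    obtain ⟨j, hj, h1, h2⟩ := hhl f hf
    rw [h1, h2]
    have h3 := hB.mono (j + 1) (d - d / 2) (by omega) (by omega)
    have h4 := hB.mono j (d / 2) (by omega) (by omega)
    linarith [hB.sum_lt hn]
  obtain ⟨h1, -, h2⟩ := htop.1 (hL.top_eq_near_of_eq hk hα0 hα1 hB.c_pos hB.K_eq hlt hx hmax hu0
    (by rw [heq, hτeq]; ring))
  have hid : i < d := by omega
  have hvi : v ⟨i, by omega⟩ = u := by
    rw [← h2 hid, hR.right_near i le_rfl hid]
    exact (hv' ⟨i, by omega⟩).symm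
  have hother : ∀ f ∈ G.edgeSet, (∀ j, f ≠ e j) → v ⟨i, by omega⟩ ∈ f := by
    intro f hf hfe
    obtain ⟨f', hf', rfl⟩ := exists_mem_edgeFinset hf
    have h3 := h1 f' hf' fun j hj hcon => hfe ⟨j, hj⟩ (by rw [hcon]; exact he' ⟨j, hj⟩)
    rw [hvi]
    exact ⟨u, h3 ▸ hR.near_mem f' hf', rfl⟩
  rcases hi with rfl | hi
  · exact ⟨v, e, hp, hother⟩
  -- Reversing the path moves the turn from ⌈d/2⌉ to ⌊d/2⌋.
  · refine ⟨_, _, hp.rev, fun f hf hfe => ?_⟩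
    have h3 := hother f hf fun j hcon => hfe j.rev (by simpa using hcon)
    have h4 : Fin.rev (⟨d / 2, by omega⟩ : Fin (d + 1)) = ⟨i, by omega⟩ :=
      Fin.ext (by simp [Fin.val_rev]; omega)
    simpa [h4] using h3

/-- With the root at the centre every edge is charged to its own nearest vertex, so some positive
vector attains the bound of `edgeForm_le_of_isPath`. -/
theorem IsBroomPath.le_alphaSpectralRadius [Fintype G.vertexSet] {α K c : ℝ} {k d : ℕ}
    (hα0 : 0 ≤ α) (hα1 : α < 1) (hk : 2 ≤ k) (hG : G.IsHypertree) (hu : G.IsUniform k)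
    (hfin : G.edgeSet.Finite) {v : Fin (d + 1) → V} {e : Fin d → Set V}
    (h : G.IsBroomPath d v e) (hd : 2 ≤ d)
    (hB : IsBalanced α K c k d (G.edgeSet.ncard - d)) : c + α ≤ G.alphaSpectralRadius k α := by
  classical
  have hp := h.isPath
  have : Nonempty G.vertexSet := ⟨⟨v 0, hp.1.1 0⟩⟩
  set u : G.vertexSet := ⟨v ⟨d / 2, by omega⟩, hp.1.1 _⟩ with hudef
  obtain ⟨near, v', e', i, hR, hv', he'⟩ := hG.exists_isRootedPath hfin (hu.nonempty hk) u hp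
  obtain ⟨top, low, h', l, rank, hL, -, htop⟩ := hR.exists_isLabelling hk
    (fun f hf => hu.card_eq hf) hα0 hB.K_pos hB.c_pos hB.lt
  rw [card_edgeFinset] at hL
  have hvp : v' (d / 2) = u := Subtype.ext (hv' ⟨d / 2, by omega⟩)
  have hroot : ∀ f ∈ G.edgeFinset, (u : V) ∈ Subtype.val '' (f : Set G.vertexSet) →
      near f = u := by
    intro f hf huf
    have huf' : u ∈ f := by simpa using huf
    by_contra hcon
    exact hR.root f hf (Finset.mem_erase.2 ⟨Ne.symm hcon, huf'⟩)
  have hcast : (Fin.succ ⟨d / 2 - 1, by omega⟩ : Fin (d + 1)) = ⟨d / 2, by omega⟩ :=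
    Fin.ext (by simp; omega)
  have hprev : near (e' (d / 2 - 1)) = u := by
    refine hroot _ (hR.mem _ (by omega)) ?_
    rw [he' ⟨d / 2 - 1, by omega⟩]
    have := (hp.1.2 ⟨d / 2 - 1, by omega⟩).2.2.1
    rwa [hcast] at this
  -- An earlier turn would make the preceding path vertex the nearest one of an edge containing the
  -- root; a later one would make the root a child.
  have hi : i = d / 2 := by
    have h1 : d / 2 ≤ i := by
      by_contra hcon
      have h2 := hR.right_near (d / 2 - 1) (by omega) (by omega)
      rw [hprev, ← hvp] at h2
      have h3 := congrArg Subtype.val h2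
      have h4 := hv' ⟨d / 2, by omega⟩
      have h5 := hv' ⟨d / 2 - 1, by omega⟩
      simp only at h4 h5
      rw [h4, h5] at h3
      have := hp.2.1 h3
      simp only [Fin.mk.injEq] at this
      omega
    by_contra hcon
    have h2 := hR.left_child (d / 2) (by omega)
    rw [hvp] at h2
    exact hR.root _ (hR.mem _ (by omega)) h2
  have htn : ∀ f ∈ G.edgeFinset, top f = near f := by
    refine htop.2 ⟨fun f hf hfe => ?_, fun _ => by rw [hi, hprev], fun hid => ?_⟩
    · refine hroot f hf (h.mem_of_ne _ (mem_edgeFinset.1 hf) fun j hcon => ?_)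
      rw [← he' j] at hcon
      exact hfe j j.2 (image_val_injective hcon)
    · rw [hR.right_near i le_rfl hid, hi, hvp]
  obtain ⟨x, hx, heq⟩ := hL.exists_edgeForm_eq hk hα0 hα1 hB.c_pos hB.K_eq htn
  refine Hypergraph.le_alphaSpectralRadius (by omega) hu hα0 hα1.le (fun y hy =>
    (edgeForm_le_of_isPath hα0 hα1 hk hG hu hfin hp hd hB hy).1) hx ?_
  rw [heq, hi, hB.sum_eq]
  ring

theorem exists_isBroomPath_pathWithPendants {m d k : ℕ} (hk : 2 ≤ k) (hdm : d ≤ m) :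
    ∃ (v : Fin (d + 1) → ℕ) (e : Fin d → Set ℕ), (pathWithPendants m d k).IsBroomPath d v e := by
  have hinj : Function.Injective fun j : ℕ => (k - 1) * j := fun i j hij =>
    Nat.eq_of_mul_eq_mul_left (by omega) hij
  refine ⟨fun j => (k - 1) * j, fun j => blockEdge d (k - 1) j, ⟨⟨fun j => ?_, fun j => ?_⟩,
    hinj.comp Fin.val_injective, (blockEdge_injective (by omega)).comp Fin.val_injective⟩, ?_⟩
  · rw [vertexSet_pathWithPendants hdm]
    exact Nat.mul_le_mul_left _ (by omega)
  · refine ⟨(mem_edgeSet_pathWithPendants hdm).2 ⟨j, by omega, rfl⟩, ?_, ?_, fun h => ?_⟩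
    · beta_reduce
      rw [blockEdge_of_lt j.2]
      exact ⟨le_rfl, Nat.mul_le_mul_left _ (by simp)⟩
    · beta_reduce
      rw [blockEdge_of_lt j.2]
      exact ⟨Nat.mul_le_mul_left _ (by simp), le_rfl⟩
    · have := hinj h
      simp at this
  · intro f hf hfe
    obtain ⟨j, hj, rfl⟩ := (mem_edgeSet_pathWithPendants hdm).1 hf
    have hdj : d ≤ j := by
      by_contra hcon
      exact hfe ⟨j, by omega⟩ rfl
    rw [blockEdge_of_le hdj]
    exact Set.mem_insert _ _

theorem IsIsomorphic.exists_equiv {W : Type*} {H : Hypergraph W} [Fintype G.vertexSet]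
    [Fintype H.vertexSet] (h : G.IsIsomorphic H) : ∃ φ : G.vertexSet ≃ H.vertexSet,
      ∀ a : Finset G.vertexSet, a ∈ G.edgeFinset ↔ φ.finsetCongr a ∈ H.edgeFinset := by
  obtain ⟨φ, hφ⟩ := h
  refine ⟨φ, fun a => ?_⟩
  rw [mem_edgeFinset, mem_edgeFinset, hφ]
  simp

theorem edgeGrad_comp_equiv {A B : Type*} [DecidableEq A] [DecidableEq B] {E : Finset (Finset A)}
    {F : Finset (Finset B)} {φ : A ≃ B} (h : ∀ a, a ∈ E ↔ φ.finsetCongr a ∈ F) (α : ℂ) (k : ℕ)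
    (x : B → ℂ) (i : A) : edgeGrad α k E (x ∘ φ) i = edgeGrad α k F x (φ i) := by
  have hmem : ∀ a, a ∈ E.filter (i ∈ ·) ↔ φ.finsetCongr a ∈ F.filter (φ i ∈ ·) := by
    intro a
    simp [Finset.mem_filter, h a]
  have hcard : (E.filter (i ∈ ·)).card = (F.filter (φ i ∈ ·)).card :=
    Finset.card_equiv φ.finsetCongr hmem
  rw [edgeGrad, edgeGrad, hcard]
  congr 2
  refine Finset.sum_equiv φ.finsetCongr hmem fun a _ => ?_
  refine Finset.prod_equiv φ (fun v => ?_) fun v _ => rfl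
  simp

theorem IsIsomorphic.alphaSpectralRadius_eq {W : Type*} {H : Hypergraph W} [Fintype G.vertexSet]
    [Fintype H.vertexSet] (h : G.IsIsomorphic H) {k : ℕ} (hk : 1 ≤ k) (hG : G.IsUniform k)
    (hH : H.IsUniform k) (α : ℝ) : G.alphaSpectralRadius k α = H.alphaSpectralRadius k α := by
  classical
  obtain ⟨φ, hφ⟩ := h.exists_equiv
  have key : ∀ μ, (G.alphaTensor k α).IsEigenvalue μ ↔ (H.alphaTensor k α).IsEigenvalue μ := by
    intro μ
    rw [isEigenvalue_alphaTensor hk hG, isEigenvalue_alphaTensor hk hH]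
    constructor
    · rintro ⟨x, hx, heq⟩
      refine ⟨x ∘ φ.symm, fun h0 => hx ?_, fun i => ?_⟩
      · funext w
        simpa using congrFun h0 (φ w)
      · have h1 := edgeGrad_comp_equiv hφ α k (x ∘ φ.symm) (φ.symm i)
        have h2 : (x ∘ φ.symm) ∘ φ = x := by funext w; simp
        rw [h2, heq, Equiv.apply_symm_apply] at h1
        exact h1.symm
    · rintro ⟨x, hx, heq⟩
      refine ⟨x ∘ φ, fun h0 => hx ?_, fun i => ?_⟩
      · funext w
        simpa using congrFun h0 (φ.symm w)
      · rw [edgeGrad_comp_equiv hφ, heq]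
        rfl
  simp only [alphaSpectralRadius, HTensor.spectralRadius, key]

theorem HasDiameter.exists_isPath {d : ℕ} (hd : G.HasDiameter d) (hG : G.IsConnected) :
    ∃ (v : Fin (d + 1) → V) (e : Fin d → Set V), G.IsPath d v e := by
  obtain ⟨⟨u, hu, w, hw, huw⟩, -⟩ := hd
  have : G.HasPath u w (G.dist u w) := Nat.sInf_mem (s := {s | G.HasPath u w s}) (hG.2 u hu w hw)
  rw [huw] at this
  obtain ⟨v, e, hp, -⟩ := this
  exact ⟨v, e, hp⟩

end Hypergraph

theorem mainTheorem2 (k m d : ℕ) (hk : 2 ≤ k) (hd : 2 ≤ d) (α : ℝ) (hα0 : 0 ≤ α) (hα1 : α < 1) :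
    (d ≤ m → (Hypergraph.pathWithPendants m d k).IsUniformHypertree k m d) ∧
    ∀ {V : Type*} (G : Hypergraph V) [Fintype G.vertexSet], G.IsUniformHypertree k m d →
      d ≤ m ∧
      G.alphaSpectralRadius k α ≤
        (Hypergraph.pathWithPendants m d k).alphaSpectralRadius k α ∧
      (G.alphaSpectralRadius k α =
          (Hypergraph.pathWithPendants m d k).alphaSpectralRadius k α ↔
        G.IsIsomorphic (Hypergraph.pathWithPendants m d k)) := by
  refine ⟨fun hdm => Hypergraph.pathWithPendants_isUniformHypertree hk hd hdm, ?_⟩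
  intro V G _ ⟨hu, hG, hfin, hcard, hdiam⟩
  obtain ⟨v, e, hp⟩ := hdiam.exists_isPath hG.1
  obtain ⟨hdm, E, hE, hEe⟩ := Hypergraph.exists_enumeration hfin hp.2.2 fun j => (hp.1.2 j).1
  have hiso : (∃ (v : Fin (d + 1) → V) (e : Fin d → Set V), G.IsBroomPath d v e) →
      G.IsIsomorphic (Hypergraph.pathWithPendants m d k) := by
    rintro ⟨v, e, h⟩
    rw [← hcard]
    exact h.isIsomorphic hk hd hG hu hfin
  have hS := Hypergraph.pathWithPendants_isUniformHypertree hk hd (hcard ▸ hdm)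
  have heq : G.IsIsomorphic (Hypergraph.pathWithPendants m d k) → G.alphaSpectralRadius k α =
      (Hypergraph.pathWithPendants m d k).alphaSpectralRadius k α := fun h =>
    h.alphaSpectralRadius_eq (by omega) hu hS.isUniform α
  have hlt : ¬ G.IsIsomorphic (Hypergraph.pathWithPendants m d k) → G.alphaSpectralRadius k α <
      (Hypergraph.pathWithPendants m d k).alphaSpectralRadius k α := by
    intro hnot
    have hno := fun h => hnot (hiso h)
    -- If there are only `d` edges, all lie on the path, which is then vacuously a broom path.
    have hdm' : d < G.edgeSet.ncard := by
      refine lt_of_le_of_ne hdm fun hdm' => hno ⟨v, e, hp, fun f hf hfe => ?_⟩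
      obtain ⟨j, hj, rfl⟩ := hE.surjOn hf
      exact absurd (hEe ⟨j, hdm' ▸ hj⟩) (hfe _)
    obtain ⟨c, K, hB⟩ := exists_isBalanced hα0 hα1 hk hd (m - d)
    obtain ⟨v', e', hbroom⟩ :=
      Hypergraph.exists_isBroomPath_pathWithPendants hk (hcard ▸ hdm : d ≤ m)
    refine lt_of_lt_of_le ?_ (hbroom.le_alphaSpectralRadius hα0 hα1 hk hS.isHypertree hS.isUniform
      hS.edgeSet_finite hd (by rwa [hS.ncard_edgeSet]))
    refine Hypergraph.alphaSpectralRadius_lt (by omega) hu hα0 hα1.le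
      (add_pos_of_pos_of_nonneg hB.c_pos hα0) fun x hx hx0 => ?_
    obtain ⟨h1, h2⟩ := Hypergraph.edgeForm_le_of_isPath hα0 hα1 hk hG hu hfin hp hd
      (hcard ▸ hB) hx
    exact lt_of_le_of_ne h1 fun h => hno (h2 hdm' hx0 h)
  refine ⟨hcard ▸ hdm, ?_, fun h => ?_, heq⟩
  · by_cases h : G.IsIsomorphic (Hypergraph.pathWithPendants m d k)
    · exact (heq h).le
    · exact (hlt h).le
  · by_contra hnot
    exact (hlt hnot).ne h
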